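/- Let $\rho\ge 0$ be a probability density on $[0,1]$ with first moment $c_1=\int_0^1 t\rho(t)\,dt$, and let $\mu\ge 0$ be an integrable density on $[0,1]$ which is the *secondary density* of $\rho$: with $S_w(z)=\int_0^1\frac{w(t)}{z-t}\,dt$, one has $S_\mu(z)=z-c_1-\frac1{S_\rho(z)}$ for all $z\in\mathbb C\setminus[0,1]$. All $L^2$ spaces below are real and over $[0,1]$. For a polynomial $p$ put $(T_\rho p)(x)=\int_0^1\frac{p(t)-p(x)}{t-x}\rho(t)\,dt$. This operator extends uniquely to a continuous linear map $T_\rho:L^2(\rho)\to L^2(\mu)$. Let $H_\rho=\{f\in L^2(\rho):\int_0^1 f\rho=0\}$ and let $\tilde T_\rho$ be the restriction of $T_\rho$ to $H_\rho$. Suppose that $\rho$ is *reducible* with *reducer* $\varphi$: with $\varphi_\varepsilon(x)=2\int_0^1\frac{(x-t)\rho(t)}{(x-t)^2+\varepsilon^2}\,dt$, one has $\varphi_\varepsilon\to\varphi$ as $\varepsilon\to0^+$ both almost everywhere on $(0,1)$ and in $L^2(\rho)$, and $\rho/\mu$ belongs to the range of $T_\rho$. Then $p\mapsto\varphi p-T_\rho(p)$,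 for $p$ a polynomial, extends uniquely to a continuous linear map $U_\rho:L^2(\rho^2/\mu)\to H_\rho$; $U_\rho$ and $\tilde T_\rho$ are isometries; and multiplication by $\mu/\rho$ is a well-defined map $F_{(\mu,\rho)}:L^2(\mu)\to L^2(\rho^2/\mu)$. Moreover: 1. $U_\rho:L^2(\rho^2/\mu)\to H_\rho$ and $\tilde T_\rho:H_\rho\to L^2(\mu)$ are bijective, with $$(U_\rho)^{-1}=F_{(\mu,\rho)}\circ\tilde T_\rho,\qquad(\tilde T_\rho)^{-1}=U_\rho\circ F_{(\mu,\rho)}.$$ 2. For every $g\in L^2(\mu)$ (in particular for every continuous $g$ on $[0,1]$), $f=U_\rho(F_{(\mu,\rho)}(g))\in H_\rho$ solves the integral equation $$\int_0^1\frac{f(t)-f(x)}{t-x}\rho(t)\,dt=g(x),$$ in the sense that $T_\rho f=g$ in $L^2(\mu)$ and that the displayed equation holds at $\rho$-almost every $x$ for which the integral converges absolutely. If $k=\frac{\mu}{\rho}g$ belongs to $L^2(\rho)$, $\varphi k$ and $T_\rho(k)$ belong to $L^2(\rho)$, and $\frac{\rho}{\mu}k$ belongs to $L^2(\mu)$, then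 this solution is $$f=\varphi\,\frac{\mu}{\rho}\,g-T_\rho\Big(\frac{\mu}{\rho}\,g\Big).$$ 3. Every function $k$ of class $C^1$ on $[0,1]$ satisfies these four conditions (so the explicit formula applies whenever $\frac{\mu}{\rho}g$ is of class $C^1$), and for such $k$ the class $T_\rho(k)$ is given by $x\mapsto\int_0^1\frac{k(t)-k(x)}{t-x}\rho(t)\,dt$. -/

import Mathlib

open MeasureTheory Filter Topology Set Polynomial

noncomputable section

/-- The measure on `[0, 1]` with density `w`. -/
def densMeasure (w : ℝ → ℝ) : Measure ℝ :=
  (volume.restrict (Icc (0 : ℝ) 1)).withDensity (fun x => ENNReal.ofReal (w x))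

/-- The real Hilbert space `L²([0, 1], w)`. -/
abbrev L2 (w : ℝ → ℝ) : Type := Lp ℝ 2 (densMeasure w)

/-- A nonnegative integrable density on `[0, 1]` (all its moments are then finite). -/
structure IsDensity (w : ℝ → ℝ) : Prop where
  nonneg : ∀ x ∈ Icc (0 : ℝ) 1, 0 ≤ w x
  integrable : IntegrableOn w (Icc 0 1)

/-- A probability density on `[0, 1]`. -/
structure IsProbabilityDensity (w : ℝ → ℝ) : Prop extends IsDensity w where
  integral_eq_one : ∫ t in Icc (0 : ℝ) 1, w t = 1

/-- The Stieltjes transform `S_w(z) = ∫ w(t) / (z - t) dt`. -/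
def stieltjes (w : ℝ → ℝ) (z : ℂ) : ℂ :=
  ∫ t in Icc (0 : ℝ) 1, (w t : ℂ) / (z - (t : ℂ))

/-- The first moment `c₁` of `w`. -/
def firstMoment (w : ℝ → ℝ) : ℝ := ∫ t in Icc (0 : ℝ) 1, t * w t

/-- `μ` is the density of the secondary measure associated with `ρ`:
`S_μ(z) = z - c₁ - 1 / S_ρ(z)` for every complex `z` outside `[0, 1]`. -/
structure IsSecondaryDensity (ρ μ : ℝ → ℝ) : Prop extends IsDensity μ where
  stieltjes_eq : ∀ z : ℂ, z ∉ Complex.ofReal '' Icc (0 : ℝ) 1 →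
    stieltjes μ z = z - (firstMoment ρ : ℂ) - 1 / stieltjes ρ z

/-- The function `x ↦ ∫ (f(t) - f(x)) / (t - x) ρ(t) dt`; for a polynomial `f` this is the
secondary polynomial associated with `f`. -/
def secondary (ρ f : ℝ → ℝ) (x : ℝ) : ℝ :=
  ∫ t in Icc (0 : ℝ) 1, (f t - f x) / (t - x) * ρ t

/-- `T : L²(ρ) → L²(μ)` is a continuous linear extension of the operator that sends a polynomial
to its secondary polynomial. -/
def ExtendsSecondary (ρ μ : ℝ → ℝ) (T : L2 ρ →L[ℝ] L2 μ) : Prop :=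
  ∀ (p : ℝ[X]) (f : L2 ρ), f =ᵐ[densMeasure ρ] (fun x => p.eval x) →
    T f =ᵐ[densMeasure μ] secondary ρ (fun x => p.eval x)

open Classical in
/-- The operator `T_ρ : L²(ρ) → L²(μ)`: the unique continuous linear extension of the operator
creating secondary polynomials (and `0` if there were no unique such extension). -/
def opT (ρ μ : ℝ → ℝ) : L2 ρ →L[ℝ] L2 μ :=
  if h : ∃! T, ExtendsSecondary ρ μ T then h.exists.choose else 0

/-- The hyperplane `H_ρ` of `L²(ρ)`: the orthogonal complement of the constants. -/
def hyperplane (ρ : ℝ → ℝ) : Submodule ℝ (L2 ρ) :=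
  (Submodule.span ℝ {f : L2 ρ | f =ᵐ[densMeasure ρ] fun _ => (1 : ℝ)})ᗮ

/-- The restriction of `T_ρ` to `H_ρ`. -/
def opTRestrict (ρ μ : ℝ → ℝ) : hyperplane ρ →L[ℝ] L2 μ :=
  (opT ρ μ).comp (hyperplane ρ).subtypeL

/-- `2 ∫ (x - t) ρ(t) / ((x - t)² + ε²) dt`. -/
def reducerApprox (ρ : ℝ → ℝ) (ε x : ℝ) : ℝ :=
  2 * ∫ t in Icc (0 : ℝ) 1, (x - t) * ρ t / ((x - t) ^ 2 + ε ^ 2)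

/-- `φ` is the reducer of `ρ`: the limit of `reducerApprox ρ ε` as `ε → 0⁺`, almost everywhere
on `(0, 1)`. -/
def IsReducer (ρ φ : ℝ → ℝ) : Prop :=
  ∀ᵐ x : ℝ, x ∈ Ioo (0 : ℝ) 1 →
    Tendsto (fun ε => reducerApprox ρ ε x) (𝓝[>] 0) (𝓝 (φ x))

/-- `ρ` (with secondary density `μ` and reducer `φ`) is reducible: the limit defining `φ` also
holds in the norm of `L²(ρ)`, and the quotient `ρ / μ` belongs to the range of `T_ρ`. -/
structure IsReducible (ρ μ φ : ℝ → ℝ) : Prop where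
  isReducer : IsReducer ρ φ
  tendsto_L2 : Tendsto (fun ε => eLpNorm (fun x => reducerApprox ρ ε x - φ x) 2 (densMeasure ρ))
    (𝓝[>] 0) (𝓝 0)
  quotient_mem_range : ∃ f : L2 ρ, opT ρ μ f =ᵐ[densMeasure μ] fun x => ρ x / μ x

/-- The density `ρ² / μ`. -/
def quotDensity (ρ μ : ℝ → ℝ) (x : ℝ) : ℝ := ρ x ^ 2 / μ x

/-- `U : L²(ρ² / μ) → H_ρ` is a continuous linear extension of `p ↦ φ p - T_ρ(p)`,
`p` a polynomial. -/
def ExtendsU (ρ μ φ : ℝ → ℝ) (U : L2 (quotDensity ρ μ) →L[ℝ] hyperplane ρ) : Prop :=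
  ∀ (p : ℝ[X]) (f : L2 (quotDensity ρ μ)),
    f =ᵐ[densMeasure (quotDensity ρ μ)] (fun x => p.eval x) →
    (U f : L2 ρ) =ᵐ[densMeasure ρ]
      fun x => φ x * p.eval x - secondary ρ (fun y => p.eval y) x

open Classical in
/-- The operator `U_ρ : L²(ρ² / μ) → H_ρ`: the unique continuous linear extension of
`p ↦ φ p - T_ρ(p)` (and `0` if there were no unique such extension). -/
def opU (ρ μ φ : ℝ → ℝ) : L2 (quotDensity ρ μ) →L[ℝ] hyperplane ρ :=
  if h : ∃! U, ExtendsU ρ μ φ U then h.exists.choose else 0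

open Classical in
/-- Multiplication by `μ / ρ`, from `L²(μ)` to `L²(ρ² / μ)` (with value `0` if the product
did not belong to the target space). -/
def opF (ρ μ : ℝ → ℝ) (g : L2 μ) : L2 (quotDensity ρ μ) :=
  if h : MemLp (fun x => μ x / ρ x * g x) 2 (densMeasure (quotDensity ρ μ)) then h.toLp _ else 0

/-- The element `f` of `L²(ρ)` lies in `H_ρ` and solves `∫ (f(t) - f(x)) / (t - x) ρ(t) dt = g(x)`:
in `L²(μ)` when the left-hand side is read as `T_ρ(f)`, and literally at almost every point `x`
at which the integral converges absolutely. -/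
structure SolvesEquation (ρ μ g : ℝ → ℝ) (f : L2 ρ) : Prop where
  mem_hyperplane : f ∈ hyperplane ρ
  opT_eq : opT ρ μ f =ᵐ[densMeasure μ] g
  integral_eq : ∀ᵐ x ∂(densMeasure ρ),
    IntegrableOn (fun t => (f t - f x) / (t - x) * ρ t) (Icc 0 1) →
      ∫ t in Icc (0 : ℝ) 1, (f t - f x) / (t - x) * ρ t = g x

/-- The conditions on an element `k` of `L²(ρ)` under which `φ k - T_ρ(k)` is formed:
`φ k` and `T_ρ(k)` belong to `L²(ρ)` and `(ρ / μ) k` belongs to `L²(μ)`. -/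
structure IsComposable (ρ μ φ : ℝ → ℝ) (k : L2 ρ) : Prop where
  mul_memLp : MemLp (fun x => φ x * k x) 2 (densMeasure ρ)
  opT_memLp : MemLp (opT ρ μ k) 2 (densMeasure ρ)
  quotient_memLp : MemLp (fun x => ρ x / μ x * k x) 2 (densMeasure μ)

end

/-! ### Measures with a density on the unit interval -/

section Density

variable {w : ℝ → ℝ}

/-! On polynomials, `T_ρ` is governed by the recursion T(Xp) = X T(p) + ∫pρ. Starting from S_ρ S_μ =
(z - c₁) S_ρ - 1, this recursion yields S_{pρ} = S_ρ (∫pρ + S_{T(p)μ}) on the upper half-plane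
(`stieltjes_polynomial`). Comparing behaviour at i∞ gives ∫T(p)μ, and a second induction gives
∫T(p)T(q)μ = ∫pqρ - ∫pρ ∫qρ (`polyIntegral_secPoly_mul_secPoly`). Polynomials being dense, T
extends, is isometric on H_ρ, and is onto L²(μ), since every polynomial is some T(p).

The reducer supplies the boundary value F = φ/2 - iπρ of S_ρ. Almost everywhere F ≠ 0: otherwise
|S_μ| would blow up along the vertical, which `IsDensity.ae_not_tendsto_norm_stieltjes` excludes by
Cauchy's theorem and Fatou's lemma. Taking imaginary parts in the defining relation then gives μ|F|²
= ρ, so ρ and μ have the same null sets and multiplication by ρ/μ is an isometry of L²(ρ²/μ) onto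
L²(μ).

Let U be that multiplication followed by the inverse of T on H_ρ; the bijectivity claims are then
formal. It remains to see that U(p) = φp - T(p). From ∫φpρ = ∫T(p)ρ and the product rule for T one
gets ∫φrkρ - ∫rT(k)ρ = ∫kT(r)ρ for r a polynomial and k in L²(ρ) (`IsReducible.integral_mul_opT`).
If y lies in H_ρ and ρk = μT(y), the isometry gives ⟨y, r⟩ = ∫T(y)T(r)μ = ∫kT(r)ρ = ⟨φk - T(k), r⟩,
whence y = φk - T(k).

The pointwise form of the equation comes from the boundary values of S_{fρ}/S_ρ = ∫fρ + S_{T(f)μ}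
(`IsReducer.ae_opT_eq_secondary`). -/

theorem IsDensity.aemeasurable (hw : IsDensity w) :
    AEMeasurable (fun x => ENNReal.ofReal (w x)) (volume.restrict (Icc (0 : ℝ) 1)) :=
  hw.integrable.aestronglyMeasurable.aemeasurable.ennreal_ofReal

theorem densMeasure_absolutelyContinuous (w : ℝ → ℝ) :
    densMeasure w ≪ volume.restrict (Icc (0 : ℝ) 1) :=
  withDensity_absolutelyContinuous _ _

theorem ae_mem_Icc_densMeasure (w : ℝ → ℝ) : ∀ᵐ x ∂densMeasure w, x ∈ Icc (0 : ℝ) 1 :=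
  densMeasure_absolutelyContinuous w (ae_restrict_mem measurableSet_Icc)

theorem IsDensity.isFiniteMeasure (hw : IsDensity w) : IsFiniteMeasure (densMeasure w) :=
  isFiniteMeasure_withDensity_ofReal hw.integrable.2

theorem IsDensity.toReal_smul_ae {f : ℝ → ℝ} (hw : IsDensity w) :
    (fun x => (ENNReal.ofReal (w x)).toReal • f x) =ᵐ[volume.restrict (Icc (0 : ℝ) 1)]
      fun x => f x * w x := by
  filter_upwards [ae_restrict_mem measurableSet_Icc] with x hx
  rw [ENNReal.toReal_ofReal (hw.nonneg x hx), smul_eq_mul, mul_comm]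

theorem IsDensity.integral_eq (hw : IsDensity w) (f : ℝ → ℝ) :
    ∫ x, f x ∂densMeasure w = ∫ x in Icc (0 : ℝ) 1, f x * w x := by
  rw [densMeasure, integral_withDensity_eq_integral_toReal_smul₀ hw.aemeasurable
    (ae_of_all _ fun x => ENNReal.ofReal_lt_top)]
  exact integral_congr_ae hw.toReal_smul_ae

theorem IsDensity.integrable_iff (hw : IsDensity w) {f : ℝ → ℝ} :
    Integrable f (densMeasure w) ↔ IntegrableOn (fun x => f x * w x) (Icc 0 1) := by
  rw [densMeasure, integrable_withDensity_iff_integrable_smul₀' hw.aemeasurable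
    (ae_of_all _ fun x => ENNReal.ofReal_lt_top)]
  exact integrable_congr hw.toReal_smul_ae

/-- The zero set of `w` carries no mass. This is the bridge between boundary limits, which hold
Lebesgue-almost everywhere, and identities in L²(w). -/
theorem IsDensity.ae_iff (hw : IsDensity w) {p : ℝ → Prop} :
    (∀ᵐ x ∂densMeasure w, p x) ↔ ∀ᵐ x ∂volume.restrict (Icc (0 : ℝ) 1), w x ≠ 0 → p x := by
  rw [densMeasure, ae_withDensity_iff' hw.aemeasurable]
  refine ⟨fun h => ?_, fun h => ?_⟩ <;>
    filter_upwards [h, ae_restrict_mem measurableSet_Icc] with x hx hxI hw0 <;> apply hx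
  · rw [Ne, ENNReal.ofReal_eq_zero, not_le]
    exact lt_of_le_of_ne (hw.nonneg x hxI) (Ne.symm hw0)
  · rintro h0
    simp [h0] at hw0

theorem IsDensity.memLp_of_continuousOn (hw : IsDensity w) {f : ℝ → ℝ} {p : ENNReal}
    (hf : ContinuousOn f (Icc 0 1)) : MemLp f p (densMeasure w) := by
  have := hw.isFiniteMeasure
  obtain ⟨C, hC⟩ := isCompact_Icc.exists_bound_of_continuousOn hf
  refine MemLp.of_bound ?_ C ?_
  · exact (hf.aestronglyMeasurable measurableSet_Icc).mono_ac (densMeasure_absolutelyContinuous w)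
  · filter_upwards [ae_mem_Icc_densMeasure w] with x hx using hC x hx

theorem IsDensity.memLp_polynomial (hw : IsDensity w) (p : ℝ[X]) {q : ENNReal} :
    MemLp (fun x => p.eval x) q (densMeasure w) :=
  hw.memLp_of_continuousOn p.continuous.continuousOn

/-- A polynomial as an element of `L²(w)`. -/
noncomputable def polyL2 (hw : IsDensity w) : ℝ[X] →ₗ[ℝ] L2 w where
  toFun p := (hw.memLp_polynomial p).toLp _
  map_add' p q := by
    rw [← MemLp.toLp_add]
    congr 1
    ext x
    simp
  map_smul' c p := by
    rw [RingHom.id_apply, ← MemLp.toLp_const_smul]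
    congr 1
    ext x
    simp

theorem coeFn_polyL2 (hw : IsDensity w) (p : ℝ[X]) :
    polyL2 hw p =ᵐ[densMeasure w] fun x => p.eval x :=
  MemLp.coeFn_toLp (hw.memLp_polynomial p)

theorem eq_polyL2 (hw : IsDensity w) {p : ℝ[X]} {f : L2 w}
    (hf : f =ᵐ[densMeasure w] fun x => p.eval x) : f = polyL2 hw p :=
  Lp.ext (hf.trans (coeFn_polyL2 hw p).symm)

/-- Bounded continuous functions are dense in L² of a finite measure, and Weierstrass approximates
them uniformly on [0, 1]. -/
theorem denseRange_polyL2 (hw : IsDensity w) : DenseRange (polyL2 hw) := by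
  have := hw.isFiniteMeasure
  rw [Metric.denseRange_iff]
  intro f ε hε
  -- `M` is the square root of the total mass, the constant comparing the L² norm with the sup norm.
  -- It may be 0, hence the `M + 1` in denominators below.
  set M : ℝ := (measureUnivNNReal (densMeasure w) : ℝ) ^ (2 : ℝ)⁻¹ with hM
  have hM0 : 0 ≤ M := by positivity
  obtain ⟨g, hg, hg2⟩ := (Lp.memLp f).exists_boundedContinuous_eLpNorm_sub_le (by simp)
    (ε := ENNReal.ofReal (ε / 3)) (by simpa using hε)
  obtain ⟨p, hp⟩ := exists_polynomial_near_of_continuousOn 0 1 g g.continuous.continuousOn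
    (ε / (3 * (M + 1))) (by positivity)
  refine ⟨p, ?_⟩
  have h1 : dist f (hg2.toLp g) ≤ ε / 3 := by
    rw [Lp.dist_def]
    refine ENNReal.toReal_le_of_le_ofReal (by positivity) (le_trans (le_of_eq ?_) hg)
    refine eLpNorm_congr_ae ?_
    filter_upwards [hg2.coeFn_toLp] with x hx
    simp [hx]
  have h2 : dist (hg2.toLp g) (polyL2 hw p) ≤ M * (ε / (3 * (M + 1))) := by
    rw [dist_eq_norm]
    have := Lp.norm_le_of_ae_bound (f := hg2.toLp g - polyL2 hw p) (C := ε / (3 * (M + 1)))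
      (by positivity) ?_
    · simpa [hM] using this
    · filter_upwards [hg2.coeFn_toLp, coeFn_polyL2 hw p, Lp.coeFn_sub (hg2.toLp g) (polyL2 hw p),
        ae_mem_Icc_densMeasure w] with x h1 h2 h3 h4
      rw [h3, Pi.sub_apply, h1, h2, Real.norm_eq_abs, abs_sub_comm]
      exact (hp x h4).le
  have h3 : M * (ε / (3 * (M + 1))) ≤ ε / 3 := by
    rw [mul_div_assoc', div_le_div_iff₀ (by positivity) (by positivity)]
    nlinarith
  have h4 := dist_triangle f (hg2.toLp g) (polyL2 hw p)
  linarith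

theorem inner_L2_eq (hw : IsDensity w) (f g : L2 w) :
    inner ℝ f g = ∫ x in Icc (0 : ℝ) 1, f x * g x * w x := by
  rw [L2.inner_def, hw.integral_eq]
  simp [mul_comm]

theorem IsDensity.integrableOn_mul (hw : IsDensity w) {f g : ℝ → ℝ}
    (hf : MemLp f 2 (densMeasure w)) (hg : MemLp g 2 (densMeasure w)) :
    IntegrableOn (fun x => f x * g x * w x) (Icc 0 1) :=
  hw.integrable_iff.1 (hf.integrable_mul hg)

theorem IsDensity.integrableOn_of_memLp (hw : IsDensity w) {f : ℝ → ℝ}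
    (hf : MemLp f 2 (densMeasure w)) : IntegrableOn (fun x => f x * w x) (Icc 0 1) :=
  have := hw.isFiniteMeasure
  hw.integrable_iff.1 (hf.integrable (by norm_num))

theorem inner_toLp_toLp (hw : IsDensity w) {f g : ℝ → ℝ} (hf : MemLp f 2 (densMeasure w))
    (hg : MemLp g 2 (densMeasure w)) :
    inner ℝ (hf.toLp f) (hg.toLp g) = ∫ x in Icc (0 : ℝ) 1, f x * g x * w x := by
  rw [L2.inner_def, ← hw.integral_eq]
  refine integral_congr_ae ?_
  filter_upwards [hf.coeFn_toLp, hg.coeFn_toLp] with x h1 h2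
  simp [h1, h2, mul_comm]

/-- The integral of a polynomial against the density `w`. -/
noncomputable def polyIntegral (hw : IsDensity w) : ℝ[X] →ₗ[ℝ] ℝ where
  toFun p := ∫ x in Icc (0 : ℝ) 1, p.eval x * w x
  map_add' p q := by
    simp only [eval_add, add_mul]
    exact integral_add (hw.integrableOn_of_memLp (hw.memLp_polynomial p))
      (hw.integrableOn_of_memLp (hw.memLp_polynomial q))
  map_smul' c p := by
    simp only [eval_smul, smul_eq_mul, mul_assoc, RingHom.id_apply]
    exact integral_const_mul _ _

theorem polyIntegral_apply (hw : IsDensity w) (p : ℝ[X]) :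
    polyIntegral hw p = ∫ x in Icc (0 : ℝ) 1, p.eval x * w x := rfl

theorem inner_polyL2 (hw : IsDensity w) (p q : ℝ[X]) :
    inner ℝ (polyL2 hw p) (polyL2 hw q) = polyIntegral hw (p * q) := by
  rw [polyIntegral_apply]
  simp only [eval_mul]
  exact inner_toLp_toLp hw (hw.memLp_polynomial p) (hw.memLp_polynomial q)

end Density

/-! ### Secondary polynomials -/

section SecondaryPolynomial

variable {ρ : ℝ → ℝ}

/-- The secondary polynomials of the monomials. -/
noncomputable def secMonomial (hρ : IsDensity ρ) : ℕ → ℝ[X]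
  | 0 => 0
  | n + 1 => X * secMonomial hρ n + C (polyIntegral hρ (X ^ n))

/-- The operator creating secondary polynomials, on polynomials. -/
noncomputable def secPoly (hρ : IsDensity ρ) : ℝ[X] →ₗ[ℝ] ℝ[X] :=
  Polynomial.lsum fun n => LinearMap.toSpanSingleton ℝ ℝ[X] (secMonomial hρ n)

theorem secPoly_monomial (hρ : IsDensity ρ) (n : ℕ) (a : ℝ) :
    secPoly hρ (C a * X ^ n) = a • secMonomial hρ n := by
  rw [C_mul_X_pow_eq_monomial, secPoly, Polynomial.lsum_apply, Polynomial.sum_monomial_index]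
  · rfl
  · simp

theorem secPoly_C (hρ : IsDensity ρ) (a : ℝ) : secPoly hρ (C a) = 0 := by
  simpa [secMonomial] using secPoly_monomial hρ 0 a

/-- This mirrors (t p(t) - x p(x))/(t - x) = x (p(t) - p(x))/(t - x) + p(t); the inductions on
polynomials below run on it. -/
theorem secPoly_X_mul (hρ : IsDensity ρ) (p : ℝ[X]) :
    secPoly hρ (X * p) = X * secPoly hρ p + C (polyIntegral hρ p) := by
  induction p using Polynomial.induction_on' with
  | add p q hp hq => simp only [mul_add, map_add, hp, hq]; ring
  | monomial n a =>
    rw [← C_mul_X_pow_eq_monomial, show (X * (C a * X ^ n) : ℝ[X]) = C a * X ^ (n + 1) by ring,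
      secPoly_monomial, secPoly_monomial, secMonomial, C_mul', map_smul]
    simp only [smul_eq_C_mul, smul_eq_mul, map_mul]
    ring

theorem secPoly_surjective (hρ : IsDensity ρ) (h1 : polyIntegral hρ 1 = 1) :
    Function.Surjective (secPoly hρ) := by
  have hX : ∀ a : ℝ, secPoly hρ (X * C a) = C a := fun a => by
    rw [secPoly_X_mul, secPoly_C, mul_zero, zero_add, ← mul_one (C a), ← smul_eq_C_mul, map_smul,
      h1, smul_eq_mul, mul_one, smul_eq_C_mul, mul_one]
  intro q
  induction q using Polynomial.induction_on with
  | C a => exact ⟨_, hX a⟩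
  | add p q hp hq =>
    obtain ⟨p', rfl⟩ := hp
    obtain ⟨q', rfl⟩ := hq
    exact ⟨p' + q', map_add _ _ _⟩
  | monomial n a h =>
    obtain ⟨p, hp⟩ := h
    -- If T(p) = q then T(Xp) = Xq + ∫pρ; since T(X·a) = a, the extra constant can be removed.
    refine ⟨X * p - X * C (polyIntegral hρ p), ?_⟩
    rw [map_sub, hX, secPoly_X_mul, hp]
    ring

theorem eval_secPoly (hρ : IsDensity ρ) (p : ℝ[X]) (x : ℝ) :
    secondary ρ (fun y => p.eval y) x = (secPoly hρ p).eval x ∧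
      IntegrableOn (fun t => (p.eval t - p.eval x) / (t - x) * ρ t) (Icc 0 1) := by
  -- At t = x the quotient has the default value 0, which does not affect the integral.
  have hx : ∀ᵐ t ∂volume.restrict (Icc (0 : ℝ) 1), t ≠ x :=
    ae_restrict_of_ae (by simp [ae_iff, measure_singleton])
  induction p using Polynomial.induction_on with
  | C a => simp [secondary, secPoly_C]
  | add p q hp hq =>
    have h : ∀ t, ((p + q).eval t - (p + q).eval x) / (t - x) * ρ t =
        (p.eval t - p.eval x) / (t - x) * ρ t + (q.eval t - q.eval x) / (t - x) * ρ t := fun t => by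
      simp only [eval_add]; ring
    simp only [secondary] at hp hq ⊢
    simp only [h]
    simp only [map_add, eval_add, ← hp.1, ← hq.1]
    exact ⟨integral_add hp.2 hq.2, hp.2.add hq.2⟩
  | monomial n a hp =>
    rw [show (C a * X ^ (n + 1) : ℝ[X]) = X * (C a * X ^ n) by ring]
    generalize (C a * X ^ n : ℝ[X]) = p at hp ⊢
    have h : (fun t => ((X * p).eval t - (X * p).eval x) / (t - x) * ρ t)
        =ᵐ[volume.restrict (Icc (0 : ℝ) 1)] fun t =>
        x * ((p.eval t - p.eval x) / (t - x) * ρ t) + p.eval t * ρ t := by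
      filter_upwards [hx] with t ht
      have := sub_ne_zero.2 ht
      simp only [eval_mul, eval_X]
      field_simp
      ring
    have h2 := hρ.integrableOn_of_memLp (hρ.memLp_polynomial p)
    refine ⟨?_, ((hp.2.const_mul x).add h2).congr h.symm⟩
    rw [secondary, integral_congr_ae h, integral_add (hp.2.const_mul x) h2, integral_const_mul,
      secPoly_X_mul, eval_add, eval_mul, eval_X, eval_C, ← hp.1]
    rfl

theorem secondary_polynomial (hρ : IsDensity ρ) (p : ℝ[X]) :
    secondary ρ (fun y => p.eval y) = fun x => (secPoly hρ p).eval x :=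
  funext fun x => (eval_secPoly hρ p x).1

/-- The operator of secondary polynomials behaves like a derivation under the integral. -/
theorem polyIntegral_secPoly_mul (hρ : IsDensity ρ) (p r : ℝ[X]) :
    polyIntegral hρ (secPoly hρ (p * r)) =
      polyIntegral hρ (r * secPoly hρ p) + polyIntegral hρ (p * secPoly hρ r) := by
  have hC : ∀ (a : ℝ) (q : ℝ[X]), polyIntegral hρ (q * C a) = a * polyIntegral hρ q := fun a q => by
    rw [mul_comm, ← smul_eq_C_mul, map_smul, smul_eq_mul]
  induction p using Polynomial.induction_on generalizing r with
  | C a => simp [secPoly_C, ← smul_eq_C_mul]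
  | add p q hp hq => simp only [add_mul, mul_add, map_add, hp, hq]; ring
  | monomial n a h =>
    rw [show (C a * X ^ (n + 1) : ℝ[X]) = X * (C a * X ^ n) by ring]
    generalize (C a * X ^ n : ℝ[X]) = p at h ⊢
    -- The factor X moves from p to r. Passing to Xp on one side and to Xr on the other creates the
    -- same extra term ∫pρ ∫rρ.
    have h1 := h (X * r)
    rw [show p * (X * r) = X * p * r by ring] at h1
    rw [h1, secPoly_X_mul, secPoly_X_mul, mul_add, mul_add, map_add, map_add, hC, hC,
      show X * r * secPoly hρ p = r * (X * secPoly hρ p) by ring,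
      show p * (X * secPoly hρ r) = X * p * secPoly hρ r by ring]
    ring

end SecondaryPolynomial

/-! ### The Stieltjes transform on the upper half-plane -/

section Stieltjes

variable {w v : ℝ → ℝ} {z : ℂ}

theorem sub_ofReal_ne_zero (hz : 0 < z.im) (t : ℝ) : z - t ≠ 0 := fun h => by
  have := congrArg Complex.im h
  simp at this
  exact hz.ne' this

theorem im_le_norm_sub (hz : 0 < z.im) (t : ℝ) : z.im ≤ ‖z - t‖ := by
  have := Complex.abs_im_le_norm (z - t)
  simpa [abs_of_pos hz] using this

theorem notMem_image_of_im_pos (hz : 0 < z.im) (s : Set ℝ) : z ∉ Complex.ofReal '' s := by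
  rintro ⟨t, -, rfl⟩
  simp at hz

theorem integrableOn_stieltjes (hw : IntegrableOn w (Icc 0 1)) (hz : 0 < z.im) :
    IntegrableOn (fun t => (w t : ℂ) / (z - t)) (Icc (0 : ℝ) 1) := by
  simp only [div_eq_mul_inv]
  refine Integrable.mul_bdd (c := z.im⁻¹) hw.ofReal ?_ (ae_of_all _ fun t => ?_)
  · refine Continuous.aestronglyMeasurable ?_
    exact Continuous.inv₀ (by fun_prop) (sub_ofReal_ne_zero hz)
  · rw [norm_inv]
    exact inv_anti₀ hz (im_le_norm_sub hz t)

theorem stieltjes_add (hw : IntegrableOn w (Icc 0 1)) (hv : IntegrableOn v (Icc 0 1))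
    (hz : 0 < z.im) : stieltjes (fun t => w t + v t) z = stieltjes w z + stieltjes v z := by
  rw [stieltjes, stieltjes, stieltjes,
    ← integral_add (integrableOn_stieltjes hw hz) (integrableOn_stieltjes hv hz)]
  simp [add_div]

theorem stieltjes_const_mul (a : ℝ) (w : ℝ → ℝ) (z : ℂ) :
    stieltjes (fun t => a * w t) z = a * stieltjes w z := by
  rw [stieltjes, stieltjes, ← integral_const_mul]
  simp [mul_div_assoc]

theorem stieltjes_id_mul (hw : IntegrableOn w (Icc 0 1)) (hz : 0 < z.im) :
    stieltjes (fun t => t * w t) z = z * stieltjes w z - (∫ t in Icc (0 : ℝ) 1, w t : ℝ) := by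
  have hw' : IntegrableOn (fun t => (w t : ℂ)) (Icc 0 1) := hw.ofReal
  rw [stieltjes, stieltjes, ← integral_const_mul, ← integral_complex_ofReal,
    ← integral_sub ((integrableOn_stieltjes hw hz).const_mul z) hw']
  refine integral_congr_ae (ae_of_all _ fun t => ?_)
  have := sub_ofReal_ne_zero hz t
  push_cast
  field_simp
  ring

theorem stieltjes_congr_ae (h : w =ᵐ[volume.restrict (Icc (0 : ℝ) 1)] v) (z : ℂ) :
    stieltjes w z = stieltjes v z := by
  refine integral_congr_ae ?_
  filter_upwards [h] with t ht
  simp only [ht]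

theorem div_sub_eq (x ε a t : ℝ) (hε : 0 < ε) : (a : ℂ) / ((x + ε * Complex.I : ℂ) - t) =
    (((x - t) * a / ((x - t) ^ 2 + ε ^ 2) : ℝ) : ℂ) -
      ((ε * a / ((x - t) ^ 2 + ε ^ 2) : ℝ) : ℂ) * Complex.I := by
  have h1 : (x + ε * Complex.I : ℂ) - t ≠ 0 := sub_ofReal_ne_zero (by simpa using hε) t
  have h2 : (((x - t) ^ 2 + ε ^ 2 : ℝ) : ℂ) ≠ 0 := by
    rw [Complex.ofReal_ne_zero]; positivity
  push_cast at h2 ⊢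
  field_simp
  ring_nf
  simp only [Complex.I_sq]
  ring

theorem stieltjes_re (hw : IntegrableOn w (Icc 0 1)) (x : ℝ) {ε : ℝ} (hε : 0 < ε) :
    (stieltjes w (x + ε * Complex.I)).re =
      ∫ t in Icc (0 : ℝ) 1, (x - t) * w t / ((x - t) ^ 2 + ε ^ 2) := by
  have hz : 0 < (x + ε * Complex.I : ℂ).im := by simpa using hε
  have := integral_re (integrableOn_stieltjes hw hz)
  simp only [RCLike.re_eq_complex_re] at this
  rw [stieltjes, ← this]
  refine integral_congr_ae (ae_of_all _ fun t => ?_)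
  simp only [div_sub_eq x ε _ t hε, Complex.sub_re, Complex.ofReal_re, Complex.re_ofReal_mul,
    Complex.I_re, mul_zero, sub_zero]

theorem stieltjes_im (hw : IntegrableOn w (Icc 0 1)) (x : ℝ) {ε : ℝ} (hε : 0 < ε) :
    (stieltjes w (x + ε * Complex.I)).im =
      -∫ t in Icc (0 : ℝ) 1, ε * w t / ((x - t) ^ 2 + ε ^ 2) := by
  have hz : 0 < (x + ε * Complex.I : ℂ).im := by simpa using hε
  have := integral_im (integrableOn_stieltjes hw hz)
  simp only [RCLike.im_eq_complex_im] at this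
  rw [stieltjes, ← this, ← integral_neg]
  refine integral_congr_ae (ae_of_all _ fun t => ?_)
  simp only [div_sub_eq x ε _ t hε, Complex.sub_im, Complex.ofReal_im, Complex.im_ofReal_mul,
    Complex.I_im, mul_one, zero_sub]

theorem IsDensity.stieltjes_im_nonpos (hw : IsDensity w) (hz : 0 < z.im) :
    (stieltjes w z).im ≤ 0 := by
  rw [← Complex.re_add_im z, stieltjes_im hw.integrable _ hz, neg_nonpos]
  refine setIntegral_nonneg measurableSet_Icc fun t ht => ?_
  have := hw.nonneg t ht
  positivity

/-- The imaginary part is minus the integral of `w` against a strictly positive kernel; its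
vanishing would force `w = 0` almost everywhere. -/
theorem IsProbabilityDensity.stieltjes_ne_zero (hw : IsProbabilityDensity w) (hz : 0 < z.im) :
    stieltjes w z ≠ 0 := by
  intro h
  have h1 := stieltjes_im hw.integrable z.re hz
  rw [Complex.re_add_im, h, Complex.zero_im, eq_comm, neg_eq_zero,
    setIntegral_eq_zero_iff_of_nonneg_ae] at h1
  · have h2 : ∫ t in Icc (0 : ℝ) 1, w t = 0 := by
      refine (integral_congr_ae ?_).trans (integral_zero _ _)
      filter_upwards [h1] with t ht
      have : (z.re - t) ^ 2 + z.im ^ 2 ≠ 0 := by positivity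
      simpa [hz.ne', this] using ht
    rw [hw.integral_eq_one] at h2
    exact one_ne_zero h2
  · filter_upwards [ae_restrict_mem measurableSet_Icc] with t ht
    have := hw.nonneg t ht
    simp only [Pi.zero_apply]
    positivity
  · have h3 := (integrableOn_stieltjes hw.integrable hz).im
    have h4 := h3.neg
    refine h4.congr (ae_of_all _ fun t => ?_)
    have := div_sub_eq z.re z.im (w t) t hz
    rw [Complex.re_add_im] at this
    simp only [Pi.neg_apply, this, RCLike.im_eq_complex_im, Complex.sub_im, Complex.ofReal_im,
      Complex.im_ofReal_mul, Complex.I_im, mul_one, zero_sub, neg_neg]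

/-- Dominated convergence, with |z| ≤ |z - t| on the imaginary axis. The limit at i∞ recovers the
total mass and is used to identify constants. -/
theorem tendsto_mul_stieltjes (hw : IntegrableOn w (Icc 0 1)) :
    Tendsto (fun R : ℝ => (R * Complex.I) * stieltjes w (R * Complex.I)) atTop
      (𝓝 ((∫ t in Icc (0 : ℝ) 1, w t : ℝ) : ℂ)) := by
  simp only [stieltjes, ← integral_const_mul, ← integral_complex_ofReal]
  refine tendsto_integral_filter_of_dominated_convergence (fun t => ‖w t‖) ?_ ?_ hw.norm ?_
  · filter_upwards [eventually_gt_atTop 0] with R hR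
    exact ((integrableOn_stieltjes hw (by simpa using hR)).const_mul _).aestronglyMeasurable
  · filter_upwards [eventually_gt_atTop 0] with R hR
    refine ae_of_all _ fun t => ?_
    have h1 := im_le_norm_sub (z := R * Complex.I) (by simpa using hR) t
    simp only [Complex.mul_im, Complex.ofReal_re, Complex.I_im, mul_one, Complex.ofReal_im,
      Complex.I_re, mul_zero, add_zero] at h1
    rw [norm_mul, norm_div, norm_mul, Complex.norm_I, mul_one, Complex.norm_real, Complex.norm_real,
      Real.norm_of_nonneg hR.le, mul_div_assoc', div_le_iff₀ (hR.trans_le h1), mul_comm]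
    exact mul_le_mul_of_nonneg_left h1 (norm_nonneg _)
  · refine ae_of_all _ fun t => ?_
    have h1 : Tendsto (fun R : ℝ => (w t : ℂ) / (1 - t * ((R : ℂ)⁻¹ * Complex.I⁻¹))) atTop
        (𝓝 ((w t : ℂ) / (1 - t * (0 * Complex.I⁻¹)))) := by
      refine Tendsto.div tendsto_const_nhds ?_ (by simp)
      refine tendsto_const_nhds.sub (tendsto_const_nhds.mul (Tendsto.mul_const _ ?_))
      have := (tendsto_inv_atTop_zero (𝕜 := ℝ)).ofReal
      simpa using this
    simp only [zero_mul, mul_zero, sub_zero, div_one] at h1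
    refine h1.congr' ?_
    filter_upwards [eventually_gt_atTop 0] with R hR
    have h2 : (R : ℂ) ≠ 0 := by simpa using hR.ne'
    have h3 := sub_ofReal_ne_zero (z := R * Complex.I) (by simpa using hR) t
    have h4 := Complex.I_ne_zero
    have h5 : (1 - t * ((R : ℂ)⁻¹ * Complex.I⁻¹)) = (R * Complex.I - t) / (R * Complex.I) := by
      field_simp
    rw [h5]
    field_simp

theorem tendsto_stieltjes_zero (hw : IntegrableOn w (Icc 0 1)) :
    Tendsto (fun R : ℝ => stieltjes w (R * Complex.I)) atTop (𝓝 0) := by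
  have h1 : Tendsto (fun R : ℝ => ((R : ℂ) * Complex.I)⁻¹) atTop (𝓝 0) := by
    have := ((tendsto_inv_atTop_zero (𝕜 := ℝ)).ofReal).mul_const Complex.I⁻¹
    simpa [mul_comm] using this
  have h2 := h1.mul (tendsto_mul_stieltjes hw)
  rw [zero_mul] at h2
  refine h2.congr' ?_
  filter_upwards [eventually_gt_atTop 0] with R hR
  have h2 : (R : ℂ) ≠ 0 := by simpa using hR.ne'
  have h4 := Complex.I_ne_zero
  field_simp

end Stieltjes

/-! ### The secondary measure and the isometry on polynomials -/

section SecondaryDensity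

variable {ρ μ : ℝ → ℝ} {z : ℂ}

theorem IsProbabilityDensity.polyIntegral_C (hρ : IsProbabilityDensity ρ) (a : ℝ) :
    polyIntegral hρ.toIsDensity (C a) = a := by
  rw [← mul_one (C a), ← smul_eq_C_mul, map_smul, polyIntegral_apply]
  simp [hρ.integral_eq_one]

theorem IsProbabilityDensity.polyIntegral_one (hρ : IsProbabilityDensity ρ) :
    polyIntegral hρ.toIsDensity 1 = 1 :=
  hρ.polyIntegral_C 1

theorem stieltjes_mul_stieltjes (hρ : IsProbabilityDensity ρ) (hμ : IsSecondaryDensity ρ μ)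
    (hz : 0 < z.im) :
    stieltjes ρ z * stieltjes μ z = (z - firstMoment ρ) * stieltjes ρ z - 1 := by
  have h := hρ.stieltjes_ne_zero hz
  rw [hμ.stieltjes_eq z (notMem_image_of_im_pos hz _)]
  field_simp

theorem stieltjes_X_mul (hw : IsDensity ρ) (p : ℝ[X]) (hz : 0 < z.im) :
    stieltjes (fun t => (X * p).eval t * ρ t) z =
      z * stieltjes (fun t => p.eval t * ρ t) z - polyIntegral hw p := by
  rw [polyIntegral_apply, ← stieltjes_id_mul (hw.integrableOn_of_memLp (hw.memLp_polynomial p)) hz]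
  simp [mul_assoc]

theorem stieltjes_secPoly_X_mul (hρ : IsProbabilityDensity ρ) (hμ : IsSecondaryDensity ρ μ)
    (p : ℝ[X]) (hz : 0 < z.im) :
    stieltjes (fun t => (secPoly hρ.toIsDensity (X * p)).eval t * μ t) z =
      z * stieltjes (fun t => (secPoly hρ.toIsDensity p).eval t * μ t) z
        - polyIntegral hμ.toIsDensity (secPoly hρ.toIsDensity p)
        + polyIntegral hρ.toIsDensity p * stieltjes μ z := by
  rw [← stieltjes_X_mul hμ.toIsDensity _ hz, ← stieltjes_const_mul, ← stieltjes_add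
    (hμ.toIsDensity.integrableOn_of_memLp (hμ.toIsDensity.memLp_polynomial _))
    (hμ.integrable.const_mul _) hz, secPoly_X_mul]
  simp [add_mul]

/-- The two conclusions come together: the recursion gives the factorization for Xp with a constant
still written through ∫T(p)μ, and behaviour at i∞ identifies that constant with ∫Xpρ. -/
theorem stieltjes_polynomial_aux (hρ : IsProbabilityDensity ρ) (hμ : IsSecondaryDensity ρ μ)
    (p : ℝ[X]) (hp : ∀ z : ℂ, 0 < z.im → stieltjes (fun t => p.eval t * ρ t) z = stieltjes ρ z *
      (polyIntegral hρ.toIsDensity p +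
        stieltjes (fun t => (secPoly hρ.toIsDensity p).eval t * μ t) z)) :
    polyIntegral hμ.toIsDensity (secPoly hρ.toIsDensity p) =
      polyIntegral hρ.toIsDensity (X * p) - firstMoment ρ * polyIntegral hρ.toIsDensity p ∧
    ∀ z : ℂ, 0 < z.im → stieltjes (fun t => (X * p).eval t * ρ t) z = stieltjes ρ z *
      (polyIntegral hρ.toIsDensity (X * p) +
        stieltjes (fun t => (secPoly hρ.toIsDensity (X * p)).eval t * μ t) z) := by
  have key : ∀ z : ℂ, 0 < z.im → stieltjes (fun t => (X * p).eval t * ρ t) z = stieltjes ρ z *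
      (stieltjes (fun t => (secPoly hρ.toIsDensity (X * p)).eval t * μ t) z +
        (polyIntegral hμ.toIsDensity (secPoly hρ.toIsDensity p) +
          firstMoment ρ * polyIntegral hρ.toIsDensity p : ℝ)) := by
    intro z hz
    rw [stieltjes_X_mul hρ.toIsDensity p hz, hp z hz, stieltjes_secPoly_X_mul hρ hμ p hz]
    have h := stieltjes_mul_stieltjes hρ hμ hz
    push_cast
    linear_combination -(polyIntegral hρ.toIsDensity p : ℂ) * h
  have hrel : polyIntegral hρ.toIsDensity (X * p) =
      polyIntegral hμ.toIsDensity (secPoly hρ.toIsDensity p) +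
          firstMoment ρ * polyIntegral hρ.toIsDensity p := by
    -- Multiply `key` by z = iR and let R → ∞: z S_ρ tends to 1 and the transform against μ tends to
    -- 0, so only the constant survives.
    have h1 := tendsto_mul_stieltjes (hρ.toIsDensity.integrableOn_of_memLp
      (hρ.toIsDensity.memLp_polynomial (X * p)))
    have h2 := (tendsto_mul_stieltjes hρ.integrable).mul ((tendsto_stieltjes_zero
      (hμ.toIsDensity.integrableOn_of_memLp (hμ.toIsDensity.memLp_polynomial
        (secPoly hρ.toIsDensity (X * p))))).add_const
        ((polyIntegral hμ.toIsDensity (secPoly hρ.toIsDensity p) +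
          firstMoment ρ * polyIntegral hρ.toIsDensity p : ℝ) : ℂ))
    rw [hρ.integral_eq_one, zero_add, Complex.ofReal_one, one_mul] at h2
    have h3 := tendsto_nhds_unique h1 (h2.congr' ?_)
    · exact Complex.ofReal_injective h3
    · filter_upwards [eventually_gt_atTop 0] with R hR
      rw [key _ (by simpa using hR), mul_assoc]
  refine ⟨by rw [hrel]; ring, fun z hz => ?_⟩
  rw [key z hz, hrel, add_comm]

theorem stieltjes_polynomial (hρ : IsProbabilityDensity ρ) (hμ : IsSecondaryDensity ρ μ)
    (p : ℝ[X]) {z : ℂ} (hz : 0 < z.im) :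
    stieltjes (fun t => p.eval t * ρ t) z = stieltjes ρ z * (polyIntegral hρ.toIsDensity p +
      stieltjes (fun t => (secPoly hρ.toIsDensity p).eval t * μ t) z) := by
  have hint : ∀ q : ℝ[X], IntegrableOn (fun t => q.eval t * ρ t) (Icc 0 1) := fun q =>
    hρ.toIsDensity.integrableOn_of_memLp (hρ.toIsDensity.memLp_polynomial q)
  have hint' : ∀ q : ℝ[X], IntegrableOn (fun t => q.eval t * μ t) (Icc 0 1) := fun q =>
    hμ.toIsDensity.integrableOn_of_memLp (hμ.toIsDensity.memLp_polynomial q)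
  induction p using Polynomial.induction_on generalizing z with
  | C a =>
    simp only [eval_C, stieltjes_const_mul, secPoly_C, eval_zero, zero_mul, hρ.polyIntegral_C]
    simp [stieltjes, mul_comm]
  | add p q hp hq =>
    simp only [eval_add, add_mul, map_add]
    rw [stieltjes_add (hint p) (hint q) hz, stieltjes_add (hint' _) (hint' _) hz, hp hz, hq hz]
    push_cast
    ring
  | monomial n a h =>
    rw [show (C a * X ^ (n + 1) : ℝ[X]) = X * (C a * X ^ n) by ring]
    exact (stieltjes_polynomial_aux hρ hμ _ fun z hz => h hz).2 z hz

theorem polyIntegral_secPoly (hρ : IsProbabilityDensity ρ) (hμ : IsSecondaryDensity ρ μ)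
    (p : ℝ[X]) : polyIntegral hμ.toIsDensity (secPoly hρ.toIsDensity p) =
      polyIntegral hρ.toIsDensity (X * p) - firstMoment ρ * polyIntegral hρ.toIsDensity p :=
  (stieltjes_polynomial_aux hρ hμ p fun _ hz => stieltjes_polynomial hρ hμ p hz).1

theorem polyIntegral_secPoly_mul_secPoly (hρ : IsProbabilityDensity ρ)
    (hμ : IsSecondaryDensity ρ μ) (p q : ℝ[X]) :
    polyIntegral hμ.toIsDensity (secPoly hρ.toIsDensity p * secPoly hρ.toIsDensity q) =
      polyIntegral hρ.toIsDensity (p * q) -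
        polyIntegral hρ.toIsDensity p * polyIntegral hρ.toIsDensity q := by
  have hC : ∀ (a : ℝ) (r : ℝ[X]), polyIntegral hμ.toIsDensity (C a * r) =
      a * polyIntegral hμ.toIsDensity r := fun a r => by
    rw [← smul_eq_C_mul, map_smul, smul_eq_mul]
  induction p using Polynomial.induction_on generalizing q with
  | C a =>
    rw [secPoly_C, zero_mul, map_zero, hρ.polyIntegral_C, ← smul_eq_C_mul, map_smul, smul_eq_mul,
      sub_self]
  | add p p' hp hp' => simp only [map_add, add_mul, hp, hp']; ring
  | monomial n a h =>
    rw [show (C a * X ^ (n + 1) : ℝ[X]) = X * (C a * X ^ n) by ring]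
    generalize (C a * X ^ n : ℝ[X]) = p at h ⊢
    -- Again X moves from one factor to the other; the two correction terms differ only through
    -- ∫T(p)μ and ∫T(q)μ, and their c₁ contributions cancel.
    have h1 := h (X * q)
    rw [secPoly_X_mul, mul_add, map_add, mul_comm _ (C _), hC, polyIntegral_secPoly hρ hμ] at h1
    rw [secPoly_X_mul, add_mul, map_add, hC, polyIntegral_secPoly hρ hμ,
      show X * p * q = p * (X * q) by ring,
      show X * secPoly hρ.toIsDensity p * secPoly hρ.toIsDensity q =
        secPoly hρ.toIsDensity p * (X * secPoly hρ.toIsDensity q) by ring]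
    linear_combination h1

end SecondaryDensity

/-! ### Boundary behaviour of Poisson integrals -/

section Poisson

/-- Superlevel sets of the Poisson kernel are balls about x, so a Poisson integral is an average of
masses of balls and the differentiation theorem applies. -/
theorem poisson_superlevel {x ε σ : ℝ} (hε : 0 < ε) (hσ : 0 < σ) (hσ1 : σ ≤ 1) :
    {t : ℝ | σ ≤ ε ^ 2 / ((x - t) ^ 2 + ε ^ 2)} =
      Metric.closedBall x (ε * √(σ⁻¹ - 1)) := by
  have h0 : ε * √(σ⁻¹ - 1) = √(ε ^ 2 * (σ⁻¹ - 1)) := by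
    rw [Real.sqrt_mul (sq_nonneg ε), Real.sqrt_sq hε.le]
  have h1 : 0 ≤ σ⁻¹ - 1 := sub_nonneg.2 ((one_le_inv₀ hσ).2 hσ1)
  ext t
  rw [mem_ofPred_eq, Metric.mem_closedBall, Real.dist_eq, abs_sub_comm, h0,
    Real.le_sqrt (abs_nonneg _) (by positivity), sq_abs, le_div_iff₀ (by positivity), mul_sub,
    mul_one, ← div_eq_mul_inv, le_sub_iff_add_le, le_div_iff₀ hσ, mul_comm]

/-- Layer-cake formula for the Poisson integral of a measure. -/
theorem lintegral_poisson (ν : Measure ℝ) (x : ℝ) {ε : ℝ} (hε : 0 < ε) :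
    ∫⁻ t, ENNReal.ofReal (ε / ((x - t) ^ 2 + ε ^ 2)) ∂ν =
      ∫⁻ σ in Ioo (0 : ℝ) 1, ENNReal.ofReal ε⁻¹ * ν (Metric.closedBall x (ε * √(σ⁻¹ - 1))) := by
  have h1 : ∀ t, ENNReal.ofReal (ε / ((x - t) ^ 2 + ε ^ 2)) =
      ENNReal.ofReal ε⁻¹ * ENNReal.ofReal (ε ^ 2 / ((x - t) ^ 2 + ε ^ 2)) := fun t => by
    rw [← ENNReal.ofReal_mul (by positivity)]
    congr 1
    field_simp
  have hc : Continuous fun t : ℝ => ε ^ 2 / ((x - t) ^ 2 + ε ^ 2) :=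
    Continuous.div (by fun_prop) (by fun_prop) fun t => by positivity
  simp only [h1]
  rw [lintegral_const_mul' _ _ ENNReal.ofReal_ne_top, lintegral_const_mul' _ _ ENNReal.ofReal_ne_top,
    lintegral_eq_lintegral_meas_le ν (ae_of_all _ fun t => by positivity) hc.aemeasurable]
  congr 1
  rw [← Ioc_union_Ioi_eq_Ioi (zero_le_one' ℝ), lintegral_union measurableSet_Ioi
    (Ioc_disjoint_Ioi le_rfl), setLIntegral_congr Ioo_ae_eq_Ioc]
  have h2 : ∫⁻ σ in Ioi (1 : ℝ), ν {t | σ ≤ ε ^ 2 / ((x - t) ^ 2 + ε ^ 2)} = 0 := by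
    rw [setLIntegral_congr_fun measurableSet_Ioi (g := fun _ => 0), lintegral_zero]
    intro σ hσ
    have : {t | σ ≤ ε ^ 2 / ((x - t) ^ 2 + ε ^ 2)} = ∅ := by
      ext t
      simp only [mem_ofPred_eq, mem_empty_iff_false, iff_false, not_le]
      refine lt_of_le_of_lt ?_ hσ
      rw [div_le_one (by positivity)]
      nlinarith [sq_nonneg (x - t)]
    simp only [this, measure_empty]
  rw [h2, add_zero]
  refine setLIntegral_congr_fun measurableSet_Ioc fun σ hσ => ?_
  simp only [poisson_superlevel hε hσ.1 hσ.2]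

/-- The layer-cake formula for Lebesgue measure at x = 0, ε = 1, where the Poisson integral is ∫
1/(1 + t²) = π. -/
theorem lintegral_poisson_profile :
    ∫⁻ σ in Ioo (0 : ℝ) 1, ENNReal.ofReal (2 * √(σ⁻¹ - 1)) = ENNReal.ofReal Real.pi := by
  have h := lintegral_poisson volume 0 one_pos
  simp only [inv_one, ENNReal.ofReal_one, one_mul, Real.volume_closedBall] at h
  rw [← h, ← integral_univ_inv_one_add_sq,
    ofReal_integral_eq_lintegral_ofReal integrable_inv_one_add_sq
      (ae_of_all _ fun t => by positivity)]
  refine lintegral_congr fun t => ?_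
  congr 1
  rw [one_div]
  ring

/-- The Poisson integral of a finite measure at a point where its density exists. -/
theorem tendsto_lintegral_poisson (ν : Measure ℝ) [IsFiniteMeasure ν] {x : ℝ} {L : ENNReal}
    (hL : L ≠ ⊤)
    (h : Tendsto (fun r => ν (Metric.closedBall x r) / volume (Metric.closedBall x r)) (𝓝[>] 0)
      (𝓝 L)) :
    Tendsto (fun ε => ∫⁻ t, ENNReal.ofReal (ε / ((x - t) ^ 2 + ε ^ 2)) ∂ν) (𝓝[>] 0)
      (𝓝 (ENNReal.ofReal Real.pi * L)) := by
  have hlt : L < L + 1 := ENNReal.lt_add_right hL one_ne_zero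
  obtain ⟨δ, hδ, hδ2⟩ := (mem_nhdsGT_iff_exists_Ioo_subset).1 (h.eventually_le_const hlt)
  have hδ0 : 0 < δ := hδ
  -- A bound for the ball ratio at all radii: `L + 1` below δ, and total mass over 2δ from δ on. It
  -- provides the dominating function.
  set M : ENNReal := L + 1 + ν univ / ENNReal.ofReal (2 * δ) with hM
  have hMtop : M ≠ ⊤ := by
    refine ENNReal.add_ne_top.2 ⟨by simp [hL], ENNReal.div_ne_top (measure_ne_top _ _) ?_⟩
    simpa using hδ0
  have hbound : ∀ r, 0 < r → ν (Metric.closedBall x r) / volume (Metric.closedBall x r) ≤ M := by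
    intro r hr
    rcases lt_or_ge r δ with h1 | h1
    · exact le_trans (hδ2 ⟨hr, h1⟩) le_self_add
    · rw [hM, Real.volume_closedBall]
      refine le_trans ?_ le_add_self
      gcongr
      exact subset_univ _
  have hr : ∀ σ ∈ Ioo (0 : ℝ) 1, 0 < √(σ⁻¹ - 1) := fun σ hσ =>
    Real.sqrt_pos.2 (sub_pos.2 ((one_lt_inv₀ hσ.1).2 hσ.2))
  -- With the factor 1/ε absorbed, the integrand is a ball ratio times a profile independent of ε.
  have hscale : ∀ ε : ℝ, 0 < ε → ∀ σ ∈ Ioo (0 : ℝ) 1,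
      ENNReal.ofReal ε⁻¹ * ν (Metric.closedBall x (ε * √(σ⁻¹ - 1))) =
        ENNReal.ofReal (2 * √(σ⁻¹ - 1)) * (ν (Metric.closedBall x (ε * √(σ⁻¹ - 1))) /
          volume (Metric.closedBall x (ε * √(σ⁻¹ - 1)))) := by
    intro ε hε σ hσ
    have h2 := hr σ hσ
    rw [Real.volume_closedBall, ENNReal.div_eq_inv_mul, ← mul_assoc]
    congr 1
    generalize √(σ⁻¹ - 1) = r at h2 ⊢
    rw [← ENNReal.ofReal_inv_of_pos (by positivity), ← ENNReal.ofReal_mul (by positivity)]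
    congr 1
    field_simp
  rw [← lintegral_poisson_profile, ← lintegral_mul_const' _ _ hL]
  have hmain : Tendsto (fun ε => ∫⁻ σ in Ioo (0 : ℝ) 1, ENNReal.ofReal ε⁻¹ *
      ν (Metric.closedBall x (ε * √(σ⁻¹ - 1)))) (𝓝[>] 0)
      (𝓝 (∫⁻ σ in Ioo (0 : ℝ) 1, ENNReal.ofReal (2 * √(σ⁻¹ - 1)) * L)) := by
    refine tendsto_lintegral_filter_of_dominated_convergence
      (fun σ => ENNReal.ofReal (2 * √(σ⁻¹ - 1)) * M) ?_ ?_ ?_ ?_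
    · refine Eventually.of_forall fun ε => Measurable.const_mul ?_ _
      have hmono : Monotone fun r => ν (Metric.closedBall x r) := fun r s hrs =>
        measure_mono (Metric.closedBall_subset_closedBall hrs)
      exact hmono.measurable.comp (by fun_prop)
    · filter_upwards [self_mem_nhdsWithin] with ε hε
      filter_upwards [ae_restrict_mem measurableSet_Ioo] with σ hσ
      rw [hscale ε hε σ hσ]
      gcongr
      exact hbound _ (mul_pos hε (hr σ hσ))
    · rw [lintegral_mul_const' _ _ hMtop, lintegral_poisson_profile]
      exact ENNReal.mul_ne_top ENNReal.ofReal_ne_top hMtop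
    · filter_upwards [ae_restrict_mem measurableSet_Ioo] with σ hσ
      have h2 := hr σ hσ
      have h1 : Tendsto (fun ε : ℝ => ε * √(σ⁻¹ - 1)) (𝓝[>] 0) (𝓝[>] 0) := by
        refine tendsto_nhdsWithin_iff.2 ⟨?_, ?_⟩
        · have : Tendsto (fun ε : ℝ => ε * √(σ⁻¹ - 1)) (𝓝 0) (𝓝 (0 * √(σ⁻¹ - 1))) :=
            (continuous_mul_const _).tendsto 0
          rw [zero_mul] at this
          exact this.mono_left nhdsWithin_le_nhds
        · filter_upwards [self_mem_nhdsWithin] with ε hε using mul_pos hε h2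
      refine (ENNReal.Tendsto.const_mul (h.comp h1) (Or.inr ENNReal.ofReal_ne_top)).congr' ?_
      filter_upwards [self_mem_nhdsWithin] with ε hε using (hscale ε hε σ hσ).symm
  refine hmain.congr' ?_
  filter_upwards [self_mem_nhdsWithin] with ε hε using (lintegral_poisson ν x hε).symm

/-- Besicovitch differentiation, the Radon–Nikodym derivative being `w` extended by 0. -/
theorem IsDensity.ae_tendsto_ratio {w : ℝ → ℝ} (hw : IsDensity w) :
    ∀ᵐ x ∂volume.restrict (Icc (0 : ℝ) 1), Tendsto (fun r =>
      densMeasure w (Metric.closedBall x r) / volume (Metric.closedBall x r)) (𝓝[>] 0)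
        (𝓝 (ENNReal.ofReal (w x))) := by
  have := hw.isFiniteMeasure
  have h1 : densMeasure w =
      volume.withDensity ((Icc (0 : ℝ) 1).indicator fun x => ENNReal.ofReal (w x)) := by
    rw [withDensity_indicator measurableSet_Icc, densMeasure]
  have h2 : (densMeasure w).rnDeriv volume =ᵐ[volume]
      (Icc (0 : ℝ) 1).indicator fun x => ENNReal.ofReal (w x) := by
    rw [h1]
    exact Measure.rnDeriv_withDensity₀ _
      ((aemeasurable_indicator_iff measurableSet_Icc).2 hw.aemeasurable)
  filter_upwards [ae_restrict_of_ae h2, ae_restrict_mem measurableSet_Icc, ae_restrict_of_ae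
    (Besicovitch.ae_tendsto_rnDeriv (densMeasure w) volume)] with x hx hxI hlim
  rwa [hx, indicator_of_mem hxI] at hlim

theorem IsDensity.ae_tendsto_poisson {w : ℝ → ℝ} (hw : IsDensity w) :
    ∀ᵐ x ∂volume.restrict (Icc (0 : ℝ) 1), Tendsto (fun ε =>
      ∫ t in Icc (0 : ℝ) 1, ε * w t / ((x - t) ^ 2 + ε ^ 2)) (𝓝[>] 0) (𝓝 (Real.pi * w x)) := by
  have := hw.isFiniteMeasure
  filter_upwards [hw.ae_tendsto_ratio, ae_restrict_mem measurableSet_Icc] with x hx hxI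
  have h1 := (ENNReal.tendsto_toReal (ENNReal.mul_ne_top ENNReal.ofReal_ne_top
    ENNReal.ofReal_ne_top)).comp (tendsto_lintegral_poisson _ ENNReal.ofReal_ne_top hx)
  rw [ENNReal.toReal_mul, ENNReal.toReal_ofReal Real.pi_pos.le,
    ENNReal.toReal_ofReal (hw.nonneg x hxI)] at h1
  refine h1.congr' ?_
  filter_upwards [self_mem_nhdsWithin] with ε hε
  have hε0 : 0 < ε := hε
  have hc : Continuous fun t : ℝ => ε / ((x - t) ^ 2 + ε ^ 2) :=
    Continuous.div (by fun_prop) (by fun_prop) fun t => by positivity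
  rw [Function.comp_apply, ← integral_eq_lintegral_of_nonneg_ae
    (ae_of_all _ fun t => by positivity) hc.aestronglyMeasurable, hw.integral_eq]
  refine integral_congr_ae (ae_of_all _ fun t => ?_)
  simp only
  ring

theorem ae_tendsto_stieltjes_im {w : ℝ → ℝ} (hw : IntegrableOn w (Icc 0 1)) :
    ∀ᵐ x : ℝ ∂volume.restrict (Icc (0 : ℝ) 1), Tendsto (fun ε : ℝ =>
      (stieltjes w (x + ε * Complex.I)).im) (𝓝[>] 0) (𝓝 (-(Real.pi * w x))) := by
  have hp : IsDensity fun x => max (w x) 0 := ⟨fun x _ => le_max_right _ _, hw.pos_part⟩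
  have hn : IsDensity fun x => max (-w x) 0 := ⟨fun x _ => le_max_right _ _, hw.neg_part⟩
  have hsub : ∀ x, w x = max (w x) 0 + (-1) * max (-w x) 0 := fun x => by
    rcases le_total (w x) 0 with h | h <;> simp [h]
  filter_upwards [hp.ae_tendsto_poisson, hn.ae_tendsto_poisson] with x h1 h2
  have h3 := h1.neg.add h2
  rw [show -(Real.pi * max (w x) 0) + Real.pi * max (-w x) 0 = -(Real.pi * w x) by
    conv_rhs => rw [hsub x]
    ring] at h3
  refine h3.congr' ?_
  filter_upwards [self_mem_nhdsWithin] with ε hε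
  have hε0 : 0 < ε := hε
  have h4 : stieltjes w = stieltjes fun x => max (w x) 0 + (-1) * max (-w x) 0 :=
    congrArg _ (funext hsub)
  rw [h4, stieltjes_add hp.integrable (hn.integrable.const_mul _) (by simpa using hε0),
    stieltjes_const_mul, Complex.add_im, Complex.im_ofReal_mul, stieltjes_im hp.integrable _ hε0,
    stieltjes_im hn.integrable _ hε0]
  ring

end Poisson

/-! ### Boundary values of the Stieltjes transforms -/

section BoundaryValues

variable {w : ℝ → ℝ}

theorem norm_stieltjes_le (w : ℝ → ℝ) {z : ℂ} (hw : IntegrableOn w (Icc 0 1))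
    (hz : ∀ t ∈ Icc (0 : ℝ) 1, 1 ≤ ‖z - t‖) :
    ‖stieltjes w z‖ ≤ ∫ t in Icc (0 : ℝ) 1, ‖w t‖ := by
  refine norm_integral_le_of_norm_le hw.norm ?_
  filter_upwards [ae_restrict_mem measurableSet_Icc] with t ht
  rw [norm_div, Complex.norm_real]
  exact div_le_self (norm_nonneg _) (hz t ht)

theorem differentiableAt_stieltjes (hw : IntegrableOn w (Icc 0 1)) {z : ℂ} (hz : 0 < z.im) :
    DifferentiableAt ℂ (stieltjes w) z := by
  have him : ∀ y ∈ Metric.ball z (z.im / 2), z.im / 2 < y.im := fun y hy => by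
    have h1 := Complex.abs_im_le_norm (y - z)
    rw [mem_ball_iff_norm] at hy
    have h2 := (abs_lt.1 (h1.trans_lt hy)).1
    rw [Complex.sub_im] at h2
    linarith
  have him0 : ∀ y ∈ Metric.ball z (z.im / 2), 0 < y.im := fun y hy =>
    (half_pos hz).trans (him y hy)
  refine (hasDerivAt_integral_of_dominated_loc_of_deriv_le
    (μ := volume.restrict (Icc (0 : ℝ) 1)) (F := fun y t => (w t : ℂ) / (y - t))
    (F' := fun y t => -(w t : ℂ) / (y - t) ^ 2) (bound := fun t => ‖w t‖ * ((z.im / 2) ^ 2)⁻¹)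
    (Metric.ball_mem_nhds z (half_pos hz)) ?_ (integrableOn_stieltjes hw hz) ?_ ?_
    (hw.norm.mul_const _) ?_).2.differentiableAt
  · filter_upwards [Metric.ball_mem_nhds z (half_pos hz)] with y hy
    exact (integrableOn_stieltjes hw (him0 y hy)).aestronglyMeasurable
  · have h1 : IntegrableOn (fun t => (w t : ℂ)) (Icc 0 1) := hw.ofReal
    simp only [div_eq_mul_inv]
    refine h1.aestronglyMeasurable.neg.mul (Continuous.aestronglyMeasurable ?_)
    exact Continuous.inv₀ (by fun_prop) fun t => pow_ne_zero 2 (sub_ofReal_ne_zero hz t)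
  · refine ae_of_all _ fun t y hy => ?_
    rw [norm_div, norm_neg, Complex.norm_real, norm_pow, div_eq_mul_inv]
    gcongr
    exact (him y hy).le.trans (im_le_norm_sub (him0 y hy) t)
  · refine ae_of_all _ fun t y hy => ?_
    have h1 := ((hasDerivAt_id y).sub_const (t : ℂ)).inv (sub_ofReal_ne_zero (him0 y hy) t)
    simp only [div_eq_mul_inv]
    refine (h1.const_mul (w t : ℂ)).congr_deriv ?_
    simp only [id]
    ring

/-- The function `1 + i S_w`, with values in `{Re ≥ 1}` on the upper half-plane. -/
theorem IsDensity.one_le_re_one_add_I_mul (hw : IsDensity w) {z : ℂ} (hz : 0 < z.im) :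
    1 ≤ (1 + Complex.I * stieltjes w z).re := by
  have := hw.stieltjes_im_nonpos hz
  simp
  exact this

theorem IsDensity.one_le_norm_one_add_I_mul (hw : IsDensity w) {z : ℂ} (hz : 0 < z.im) :
    1 ≤ ‖1 + Complex.I * stieltjes w z‖ :=
  (hw.one_le_re_one_add_I_mul hz).trans (Complex.re_le_norm _)

theorem IsDensity.differentiableAt_log (hw : IsDensity w) {z : ℂ} (hz : 0 < z.im) :
    DifferentiableAt ℂ (fun z => Complex.log (1 + Complex.I * stieltjes w z)) z := by
  refine DifferentiableAt.clog ?_ ?_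
  · exact ((differentiableAt_stieltjes hw.integrable hz).const_mul _).const_add _
  · exact Or.inl (one_pos.trans_le (hw.one_le_re_one_add_I_mul hz))

theorem IsDensity.norm_log_le (hw : IsDensity w) {z : ℂ} (hz : 0 < z.im)
    (hz1 : ∀ t ∈ Icc (0 : ℝ) 1, 1 ≤ ‖z - t‖) :
    ‖Complex.log (1 + Complex.I * stieltjes w z)‖ ≤
      Real.log (1 + ∫ t in Icc (0 : ℝ) 1, ‖w t‖) + Real.pi := by
  have h1 := hw.one_le_norm_one_add_I_mul hz
  refine (Complex.norm_le_abs_re_add_abs_im _).trans (add_le_add ?_ ?_)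
  · rw [Complex.log_re, abs_of_nonneg (Real.log_nonneg h1)]
    refine Real.log_le_log (one_pos.trans_le h1) ((norm_add_le _ _).trans ?_)
    rw [norm_mul, Complex.norm_I, one_mul, norm_one]
    gcongr
    exact norm_stieltjes_le w hw.integrable hz1
  · rw [Complex.log_im]
    exact Complex.abs_arg_le_pi _

/-- A bound, uniform in `ε`, obtained from Cauchy's theorem on a rectangle. -/
theorem IsDensity.lintegral_log_le (hw : IsDensity w) {ε : ℝ} (hε : 0 < ε) (hε1 : ε < 1) :
    ∫⁻ x : ℝ in Icc (0 : ℝ) 1, ENNReal.ofReal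
      (Real.log ‖1 + Complex.I * stieltjes w (x + ε * Complex.I)‖) ≤
      ENNReal.ofReal (5 * (Real.log (1 + ∫ t in Icc (0 : ℝ) 1, ‖w t‖) + Real.pi)) := by
  set B := Real.log (1 + ∫ t in Icc (0 : ℝ) 1, ‖w t‖) + Real.pi with hB
  set g : ℂ → ℂ := fun z => Complex.log (1 + Complex.I * stieltjes w z) with hg
  have hB0 : 0 ≤ B := add_nonneg (Real.log_nonneg (le_add_of_nonneg_right
    (integral_nonneg fun t => norm_nonneg _))) Real.pi_pos.le
  -- The rectangle has corners -1 + iε and 2 + i. Its top and vertical sides stay at distance at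
  -- least 1 from [0, 1], so Cauchy's theorem bounds the integral over the bottom side independently
  -- of ε.
  have hrect := Complex.integral_boundary_rect_eq_zero_of_differentiableOn g
    (⟨-1, ε⟩ : ℂ) (⟨2, 1⟩ : ℂ) ?_
  swap
  · intro z hz
    rw [Complex.mem_reProdIm, uIcc_of_le hε1.le] at hz
    exact (hw.differentiableAt_log (hε.trans_le hz.2.1)).differentiableWithinAt
  simp only at hrect
  have htop : ‖∫ x : ℝ in (-1)..2, g (x + (1 : ℝ) * Complex.I)‖ ≤ B * |2 - (-1)| := by
    refine intervalIntegral.norm_integral_le_of_norm_le_const fun x _ => ?_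
    have hz : 0 < ((x : ℂ) + (1 : ℝ) * Complex.I).im := by simp
    refine hw.norm_log_le hz fun t _ => le_trans ?_ (im_le_norm_sub hz t)
    simp
  have hside : ∀ c : ℝ, (∀ t ∈ Icc (0 : ℝ) 1, 1 ≤ |c - t|) →
      ‖∫ y : ℝ in ε..1, g (c + y * Complex.I)‖ ≤ B * |1 - ε| := by
    intro c hc
    refine intervalIntegral.norm_integral_le_of_norm_le_const fun y hy => ?_
    rw [uIoc_of_le hε1.le] at hy
    have hz : 0 < ((c : ℂ) + y * Complex.I).im := by simpa using hε.trans hy.1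
    refine hw.norm_log_le hz fun t ht => (hc t ht).trans ?_
    have := Complex.abs_re_le_norm ((c : ℂ) + y * Complex.I - t)
    simpa using this
  have hright := hside 2 fun t ht => by
    rw [abs_of_nonneg] <;> linarith [ht.2]
  have hleft := hside (-1) fun t ht => by
    rw [abs_of_nonpos] <;> linarith [ht.1]
  have hε2 : |1 - ε| ≤ 1 := by rw [abs_of_nonneg] <;> linarith
  -- The 5 is 3 + 1 + 1: the length of the top side plus bounds for the two vertical ones.
  have hbottom : ‖∫ x : ℝ in (-1)..2, g (x + ε * Complex.I)‖ ≤ 5 * B := by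
    have heq : ∫ x : ℝ in (-1)..2, g (x + ε * Complex.I) =
        (∫ x : ℝ in (-1)..2, g (x + (1 : ℝ) * Complex.I)) -
          Complex.I • (∫ y : ℝ in ε..1, g ((2 : ℝ) + y * Complex.I)) +
          Complex.I • ∫ y : ℝ in ε..1, g ((-1 : ℝ) + y * Complex.I) := by
      linear_combination hrect
    rw [heq]
    refine (norm_add_le _ _).trans ((add_le_add (norm_sub_le _ _) le_rfl).trans ?_)
    rw [norm_smul, norm_smul, Complex.norm_I, one_mul, one_mul]
    have h3 : B * |1 - ε| ≤ B * 1 := by gcongr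
    have h4 : |(2 : ℝ) - (-1)| = 3 := by norm_num
    rw [h4] at htop
    linarith
  have hcont : Continuous fun x : ℝ => g (x + ε * Complex.I) := by
    refine continuous_iff_continuousAt.2 fun x => ?_
    have hz : 0 < ((x : ℂ) + ε * Complex.I).im := by simpa using hε
    exact ContinuousAt.comp (f := fun x : ℝ => (x : ℂ) + ε * Complex.I)
      (hw.differentiableAt_log hz).continuousAt (by fun_prop)
  have hre : ∀ x : ℝ, (g (x + ε * Complex.I)).re =
      Real.log ‖1 + Complex.I * stieltjes w (x + ε * Complex.I)‖ := fun x => Complex.log_re _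
  have hint : IntegrableOn (fun x : ℝ => g (x + ε * Complex.I)) (Ioc (-1) 2) :=
    (hcont.integrableOn_Icc).mono_set Ioc_subset_Icc_self
  calc
    _ ≤ ∫⁻ x : ℝ in Ioc (-1 : ℝ) 2, ENNReal.ofReal
          (Real.log ‖1 + Complex.I * stieltjes w (x + ε * Complex.I)‖) :=
        lintegral_mono_set fun x hx => ⟨by linarith [hx.1], by linarith [hx.2]⟩
    _ = ENNReal.ofReal (∫ x : ℝ in Ioc (-1 : ℝ) 2, (g (x + ε * Complex.I)).re) := by
        have hint' : IntegrableOn (fun x : ℝ => (g (x + ε * Complex.I)).re) (Ioc (-1) 2) := hint.re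
        rw [ofReal_integral_eq_lintegral_ofReal hint']
        · simp only [hre]
        · refine ae_of_all _ fun x => ?_
          have hz : 0 < ((x : ℂ) + ε * Complex.I).im := by simpa using hε
          simp only [Pi.zero_apply, hre]
          exact Real.log_nonneg (hw.one_le_norm_one_add_I_mul hz)
    _ ≤ _ := by
        refine ENNReal.ofReal_le_ofReal ?_
        have h5 := integral_re hint
        simp only [RCLike.re_eq_complex_re] at h5
        rw [h5, ← intervalIntegral.integral_of_le (by norm_num)]
        exact (Complex.re_le_norm _).trans hbottom

/-- By Fatou and the uniform bound, the lower limit of log |1 + i S_w| along a sequence ε_n → 0 is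
integrable, hence finite almost everywhere. -/
theorem IsDensity.ae_not_tendsto_norm_stieltjes (hw : IsDensity w) :
    ∀ᵐ x : ℝ ∂volume.restrict (Icc (0 : ℝ) 1),
      ¬ Tendsto (fun ε : ℝ => ‖stieltjes w (x + ε * Complex.I)‖) (𝓝[>] 0) atTop := by
  -- The sequence 1/(n + 2), shifted so that every term is below 1, as the rectangle requires.
  set ε : ℕ → ℝ := fun n => 1 / ((n + 1 : ℕ) + 1 : ℝ) with hε
  have hε0 : ∀ n, 0 < ε n := fun n => by positivity
  have hε1 : ∀ n, ε n < 1 := fun n => by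
    rw [hε, div_lt_one (by positivity)]
    push_cast
    linarith [n.cast_nonneg (α := ℝ)]
  have hlim : Tendsto ε atTop (𝓝[>] 0) := by
    refine tendsto_nhdsWithin_iff.2 ⟨?_, Eventually.of_forall hε0⟩
    exact (tendsto_one_div_add_atTop_nhds_zero_nat (𝕜 := ℝ)).comp (tendsto_add_atTop_nat 1)
  set u : ℕ → ℝ → ENNReal := fun n x => ENNReal.ofReal
    (Real.log ‖1 + Complex.I * stieltjes w (x + ε n * Complex.I)‖) with hu
  have hmeas : ∀ n, Measurable (u n) := fun n => by
    have hcont : Continuous fun x : ℝ => stieltjes w (x + ε n * Complex.I) := by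
      refine continuous_iff_continuousAt.2 fun x => ?_
      have hz : 0 < ((x : ℂ) + ε n * Complex.I).im := by simpa using hε0 n
      exact ContinuousAt.comp (f := fun x : ℝ => (x : ℂ) + ε n * Complex.I)
        (differentiableAt_stieltjes hw.integrable hz).continuousAt (by fun_prop)
    have := hcont.measurable
    fun_prop
  have hfatou := (lintegral_liminf_le (u := atTop) (μ := volume.restrict (Icc (0 : ℝ) 1)) hmeas).trans
    (liminf_le_of_frequently_le' (Frequently.of_forall fun n =>
      hw.lintegral_log_le (hε0 n) (hε1 n)))
  filter_upwards [ae_lt_top (Measurable.liminf hmeas) (hfatou.trans_lt ENNReal.ofReal_lt_top).ne]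
    with x hx htend
  have h1 := htend.comp hlim
  have h2 : Tendsto (fun n => ‖1 + Complex.I * stieltjes w (x + ε n * Complex.I)‖) atTop atTop := by
    refine tendsto_atTop_mono (fun n => ?_) (tendsto_atTop_add_const_right _ (-1) h1)
    have := norm_sub_norm_le (Complex.I * stieltjes w (x + ε n * Complex.I)) (-1)
    rw [norm_mul, Complex.norm_I, one_mul, norm_neg, norm_one, sub_neg_eq_add, add_comm _ (1 : ℂ)]
      at this
    simpa [sub_eq_add_neg] using this
  have h3 : Tendsto (fun n => u n x) atTop (𝓝 ⊤) :=
    ENNReal.tendsto_ofReal_atTop.comp (Real.tendsto_log_atTop.comp h2)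
  rw [h3.liminf_eq] at hx
  exact lt_irrefl _ hx

variable {ρ μ φ : ℝ → ℝ}

theorem reducerApprox_eq (hρ : IntegrableOn ρ (Icc 0 1)) (x : ℝ) {ε : ℝ} (hε : 0 < ε) :
    reducerApprox ρ ε x = 2 * (stieltjes ρ (x + ε * Complex.I)).re := by
  rw [stieltjes_re hρ x hε, reducerApprox]

theorem IsReducer.ae_restrict (hφ : IsReducer ρ φ) :
    ∀ᵐ x ∂volume.restrict (Icc (0 : ℝ) 1),
      Tendsto (fun ε => reducerApprox ρ ε x) (𝓝[>] 0) (𝓝 (φ x)) := by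
  rw [← restrict_Ioo_eq_restrict_Icc]
  exact (ae_restrict_iff' measurableSet_Ioo).2 hφ

/-- The boundary value of the Stieltjes transform of `ρ`. -/
noncomputable def boundaryValue (ρ φ : ℝ → ℝ) (x : ℝ) : ℂ := ⟨φ x / 2, -(Real.pi * ρ x)⟩

theorem IsReducer.ae_tendsto_stieltjes (hρ : IsDensity ρ) (hφ : IsReducer ρ φ) :
    ∀ᵐ x : ℝ ∂volume.restrict (Icc (0 : ℝ) 1),
      Tendsto (fun ε : ℝ => stieltjes ρ (x + ε * Complex.I)) (𝓝[>] 0)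
        (𝓝 (boundaryValue ρ φ x)) := by
  filter_upwards [hφ.ae_restrict, ae_tendsto_stieltjes_im hρ.integrable] with x h1 h2
  have h3 : Tendsto (fun ε : ℝ => (stieltjes ρ (x + ε * Complex.I)).re) (𝓝[>] 0)
      (𝓝 (φ x / 2)) := by
    refine (h1.div_const 2).congr' ?_
    filter_upwards [self_mem_nhdsWithin] with ε hε
    rw [reducerApprox_eq hρ.integrable x hε]
    ring
  have h4 := h3.ofReal.add (h2.ofReal.mul_const Complex.I)
  have h5 : ((φ x / 2 : ℝ) : ℂ) + ((-(Real.pi * ρ x) : ℝ) : ℂ) * Complex.I =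
      boundaryValue ρ φ x := Complex.re_add_im (boundaryValue ρ φ x)
  refine (h5 ▸ h4).congr fun ε => ?_
  exact Complex.re_add_im _

/-- If S_ρ → 0, then S_ρ S_μ = (z - c₁) S_ρ - 1 → -1, so |S_μ| → ∞, which happens only on a null
set. -/
theorem IsReducer.ae_boundaryValue_ne_zero (hρ : IsProbabilityDensity ρ)
    (hμ : IsSecondaryDensity ρ μ) (hφ : IsReducer ρ φ) :
    ∀ᵐ x : ℝ ∂volume.restrict (Icc (0 : ℝ) 1), boundaryValue ρ φ x ≠ 0 := by
  filter_upwards [hφ.ae_tendsto_stieltjes hρ.toIsDensity,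
    hμ.toIsDensity.ae_not_tendsto_norm_stieltjes] with x h1 h2 h0
  rw [h0] at h1
  refine h2 ?_
  have hz : Tendsto (fun ε : ℝ => (x + ε * Complex.I : ℂ)) (𝓝[>] 0) (𝓝 x) := by
    have : Continuous fun ε : ℝ => (x + ε * Complex.I : ℂ) := by fun_prop
    have := this.tendsto 0
    simp only [Complex.ofReal_zero, zero_mul, add_zero] at this
    exact this.mono_left nhdsWithin_le_nhds
  have h3 := (((hz.sub_const (firstMoment ρ : ℂ)).mul h1).sub_const 1).norm
  simp only [mul_zero, zero_sub, norm_neg, norm_one] at h3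
  have h4 : Tendsto (fun ε : ℝ => ‖(stieltjes ρ (x + ε * Complex.I))⁻¹‖) (𝓝[>] 0) atTop := by
    refine tendsto_norm_inv_nhdsNE_zero_atTop.comp
      (tendsto_nhdsWithin_iff.2 ⟨h1, ?_⟩)
    filter_upwards [self_mem_nhdsWithin] with ε hε
    exact hρ.stieltjes_ne_zero (by simpa using hε)
  refine (h3.pos_mul_atTop one_pos h4).congr' ?_
  filter_upwards [self_mem_nhdsWithin] with ε hε
  have hz' : 0 < ((x : ℂ) + ε * Complex.I).im := by simpa using hε
  rw [← norm_mul, ← stieltjes_mul_stieltjes hρ hμ hz', mul_comm,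
    inv_mul_cancel_left₀ (hρ.stieltjes_ne_zero hz')]

/-- `μ = ρ / (φ² / 4 + π² ρ²)` almost everywhere. -/
theorem IsReducer.ae_mul_normSq (hρ : IsProbabilityDensity ρ)
    (hμ : IsSecondaryDensity ρ μ) (hφ : IsReducer ρ φ) :
    ∀ᵐ x : ℝ ∂volume.restrict (Icc (0 : ℝ) 1),
      μ x * Complex.normSq (boundaryValue ρ φ x) = ρ x := by
  filter_upwards [hφ.ae_tendsto_stieltjes hρ.toIsDensity, hφ.ae_boundaryValue_ne_zero hρ hμ,
    ae_tendsto_stieltjes_im hμ.integrable] with x h1 h2 h3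
  have hz : Tendsto (fun ε : ℝ => (x + ε * Complex.I : ℂ)) (𝓝[>] 0) (𝓝 x) := by
    have : Continuous fun ε : ℝ => (x + ε * Complex.I : ℂ) := by fun_prop
    have := this.tendsto 0
    simp only [Complex.ofReal_zero, zero_mul, add_zero] at this
    exact this.mono_left nhdsWithin_le_nhds
  have h4 := (hz.sub_const (firstMoment ρ : ℂ)).sub (h1.inv₀ h2)
  -- Imaginary parts in S_μ = z - c₁ - 1/S_ρ: the left side tends to -πμ, the right side to Im F /
  -- |F|² = -πρ / |F|².
  have h5 := ((Complex.continuous_im.tendsto _).comp h4).congr' (f₂ := fun ε : ℝ =>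
    (stieltjes μ (x + ε * Complex.I)).im) ?_
  · have h6 := tendsto_nhds_unique h3 h5
    have h7 : Complex.normSq (boundaryValue ρ φ x) ≠ 0 := by simpa using h2
    simp only [Complex.sub_im, Complex.ofReal_im, sub_zero, zero_sub, Complex.inv_im] at h6
    rw [neg_div, neg_neg, eq_div_iff h7] at h6
    simp only [boundaryValue] at h6 ⊢
    have := Real.pi_ne_zero
    refine mul_left_cancel₀ this ?_
    linarith
  · filter_upwards [self_mem_nhdsWithin] with ε hε
    rw [hμ.stieltjes_eq _ (notMem_image_of_im_pos (by simpa using hε) _), one_div]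
    rfl

theorem IsReducer.ae_eq_zero_iff (hρ : IsProbabilityDensity ρ)
    (hμ : IsSecondaryDensity ρ μ) (hφ : IsReducer ρ φ) :
    ∀ᵐ x : ℝ ∂volume.restrict (Icc (0 : ℝ) 1), μ x = 0 ↔ ρ x = 0 := by
  filter_upwards [hφ.ae_boundaryValue_ne_zero hρ hμ, hφ.ae_mul_normSq hρ hμ] with x h1 h2
  rw [← h2, mul_eq_zero, Complex.normSq_eq_zero]
  tauto

end BoundaryValues

/-! ### The operator `T_ρ` -/

section OperatorT

variable {ρ μ φ : ℝ → ℝ}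

theorem norm_polyL2_secPoly_le (hρ : IsProbabilityDensity ρ) (hμ : IsSecondaryDensity ρ μ)
    (p : ℝ[X]) : ‖polyL2 hμ.toIsDensity (secPoly hρ.toIsDensity p)‖ ≤
      1 * ‖polyL2 hρ.toIsDensity p‖ := by
  rw [one_mul]
  refine (sq_le_sq₀ (norm_nonneg _) (norm_nonneg _)).1 ?_
  rw [← real_inner_self_eq_norm_sq, ← real_inner_self_eq_norm_sq, inner_polyL2, inner_polyL2,
    polyIntegral_secPoly_mul_secPoly hρ hμ]
  exact sub_le_self _ (mul_self_nonneg _)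

theorem extendsSecondary_iff (hρ : IsDensity ρ) (hμ : IsDensity μ) {T : L2 ρ →L[ℝ] L2 μ} :
    ExtendsSecondary ρ μ T ↔ ∀ p, T (polyL2 hρ p) = polyL2 hμ (secPoly hρ p) := by
  refine ⟨fun h p => eq_polyL2 hμ ?_, fun h p f hf => ?_⟩
  · have := h p _ (coeFn_polyL2 hρ p)
    rwa [secondary_polynomial hρ] at this
  · rw [eq_polyL2 hρ hf, h, secondary_polynomial hρ]
    exact coeFn_polyL2 hμ _

theorem existsUnique_extendsSecondary (hρ : IsProbabilityDensity ρ)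
    (hμ : IsSecondaryDensity ρ μ) : ∃! T, ExtendsSecondary ρ μ T := by
  simp only [extendsSecondary_iff hρ.toIsDensity hμ.toIsDensity]
  have hext := LinearMap.extendOfNorm_eq
    (f := polyL2 hμ.toIsDensity ∘ₗ secPoly hρ.toIsDensity) (denseRange_polyL2 hρ.toIsDensity)
    ⟨1, fun p => norm_polyL2_secPoly_le hρ hμ p⟩
  refine ⟨(polyL2 hμ.toIsDensity ∘ₗ secPoly hρ.toIsDensity).extendOfNorm
    (polyL2 hρ.toIsDensity), fun p => ?_, fun T hT => ?_⟩
  · exact hext p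
  · refine ContinuousLinearMap.coeFn_injective
      ((denseRange_polyL2 hρ.toIsDensity).equalizer T.continuous
      (ContinuousLinearMap.continuous _) (funext fun p => ?_))
    rw [Function.comp_apply, Function.comp_apply, hT]
    exact (hext p).symm

theorem extendsSecondary_opT (hρ : IsProbabilityDensity ρ) (hμ : IsSecondaryDensity ρ μ) :
    ExtendsSecondary ρ μ (opT ρ μ) := by
  have h := existsUnique_extendsSecondary hρ hμ
  rw [opT, dif_pos h]
  exact h.exists.choose_spec

theorem opT_polyL2 (hρ : IsProbabilityDensity ρ) (hμ : IsSecondaryDensity ρ μ) (p : ℝ[X]) :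
    opT ρ μ (polyL2 hρ.toIsDensity p) = polyL2 hμ.toIsDensity (secPoly hρ.toIsDensity p) :=
  (extendsSecondary_iff hρ.toIsDensity hμ.toIsDensity).1 (extendsSecondary_opT hρ hμ) p

/-- Continuity and density carry the polynomial identity over. The correction has rank one and
vanishes on H_ρ. -/
theorem inner_opT (hρ : IsProbabilityDensity ρ) (hμ : IsSecondaryDensity ρ μ) (f g : L2 ρ) :
    inner ℝ (opT ρ μ f) (opT ρ μ g) = inner ℝ f g -
      inner ℝ f (polyL2 hρ.toIsDensity 1) * inner ℝ g (polyL2 hρ.toIsDensity 1) := by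
  refine (denseRange_polyL2 hρ.toIsDensity).induction_on₂ (p := fun f g : L2 ρ =>
    inner ℝ (opT ρ μ f) (opT ρ μ g) = inner ℝ f g -
      inner ℝ f (polyL2 hρ.toIsDensity 1) * inner ℝ g (polyL2 hρ.toIsDensity 1)) ?_ ?_ f g
  · exact isClosed_eq (by fun_prop) (by fun_prop)
  · intro p q
    simp only [opT_polyL2 hρ hμ, inner_polyL2, mul_one, polyIntegral_secPoly_mul_secPoly hρ hμ]

theorem mem_hyperplane_iff (hρ : IsDensity ρ) {f : L2 ρ} :
    f ∈ hyperplane ρ ↔ inner ℝ f (polyL2 hρ 1) = 0 := by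
  have h : {f : L2 ρ | f =ᵐ[densMeasure ρ] fun _ => (1 : ℝ)} = {polyL2 hρ 1} := by
    ext g
    have h1 := coeFn_polyL2 hρ 1
    simp only [eval_one] at h1
    refine ⟨fun hg => ?_, fun hg => ?_⟩
    · exact Lp.ext (Filter.EventuallyEq.trans hg h1.symm)
    · rw [mem_singleton_iff] at hg
      subst hg
      exact h1
  rw [hyperplane, h, Submodule.mem_orthogonal_singleton_iff_inner_left]

theorem isometry_opTRestrict (hρ : IsProbabilityDensity ρ) (hμ : IsSecondaryDensity ρ μ) :
    Isometry (opTRestrict ρ μ) := by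
  refine AddMonoidHomClass.isometry_of_norm _ fun f => ?_
  have h := inner_opT hρ hμ f f
  rw [(mem_hyperplane_iff hρ.toIsDensity).1 f.2, mul_zero, sub_zero,
    real_inner_self_eq_norm_sq, real_inner_self_eq_norm_sq] at h
  exact (sq_eq_sq₀ (norm_nonneg _) (norm_nonneg _)).1 h

theorem completeSpace_hyperplane (ρ : ℝ → ℝ) : CompleteSpace (hyperplane ρ) :=
  (Submodule.isClosed_orthogonal _).completeSpace_coe

/-- An isometry from a complete space has closed range; this one contains all polynomials, since
subtracting its mean puts p in H_ρ without changing T(p). -/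
theorem surjective_opTRestrict (hρ : IsProbabilityDensity ρ) (hμ : IsSecondaryDensity ρ μ) :
    Function.Surjective (opTRestrict ρ μ) := by
  have := completeSpace_hyperplane ρ
  have hcl := (isometry_opTRestrict hρ hμ).isClosedEmbedding.isClosed_range
  have hmem : ∀ q, polyL2 hμ.toIsDensity q ∈ range (opTRestrict ρ μ) := fun q => by
    obtain ⟨p, rfl⟩ := secPoly_surjective hρ.toIsDensity hρ.polyIntegral_one q
    refine ⟨⟨polyL2 hρ.toIsDensity (p - C (polyIntegral hρ.toIsDensity p)), ?_⟩, ?_⟩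
    · rw [mem_hyperplane_iff hρ.toIsDensity, inner_polyL2, mul_one, map_sub, hρ.polyIntegral_C,
        sub_self]
    · change opT ρ μ (polyL2 hρ.toIsDensity _) = _
      rw [opT_polyL2 hρ hμ, map_sub, secPoly_C, sub_zero]
  intro g
  exact (denseRange_polyL2 hμ.toIsDensity).induction_on (p := fun g => g ∈ range (opTRestrict ρ μ))
    g hcl hmem

theorem bijective_opTRestrict (hρ : IsProbabilityDensity ρ) (hμ : IsSecondaryDensity ρ μ) :
    Function.Bijective (opTRestrict ρ μ) :=
  ⟨(isometry_opTRestrict hρ hμ).injective, surjective_opTRestrict hρ hμ⟩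

theorem IsDensity.mul_congr_ae {w f g : ℝ → ℝ} (hw : IsDensity w) (h : f =ᵐ[densMeasure w] g) :
    (fun x => f x * w x) =ᵐ[volume.restrict (Icc (0 : ℝ) 1)] fun x => g x * w x := by
  filter_upwards [hw.ae_iff.1 h] with x hx
  by_cases h0 : w x = 0
  · simp [h0]
  · rw [hx h0]

theorem continuous_stieltjes_L2 {w : ℝ → ℝ} (hw : IsDensity w) {z : ℂ} (hz : 0 < z.im) :
    Continuous fun f : L2 w => stieltjes (fun t => f t * w t) z := by
  have hint : ∀ f : L2 w, IntegrableOn (fun t => f t * w t) (Icc 0 1) := fun f =>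
    hw.integrableOn_of_memLp (Lp.memLp f)
  have hd : ∀ t : ℝ, (z.re - t) ^ 2 + z.im ^ 2 ≠ 0 := fun t => by positivity
  have h1 : MemLp (fun t : ℝ => (z.re - t) / ((z.re - t) ^ 2 + z.im ^ 2)) 2 (densMeasure w) :=
    hw.memLp_of_continuousOn
      (Continuous.div (by fun_prop) (by fun_prop) hd).continuousOn
  have h2 : MemLp (fun t : ℝ => z.im / ((z.re - t) ^ 2 + z.im ^ 2)) 2 (densMeasure w) :=
    hw.memLp_of_continuousOn
      (Continuous.div (by fun_prop) (by fun_prop) hd).continuousOn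
  have hre : ∀ f : L2 w, (stieltjes (fun t => f t * w t) z).re =
      inner ℝ (h1.toLp _) f := fun f => by
    conv_lhs => rw [← Complex.re_add_im z, stieltjes_re (hint f) _ hz]
    rw [inner_L2_eq hw]
    refine integral_congr_ae ?_
    filter_upwards [hw.mul_congr_ae h1.coeFn_toLp] with x hx
    linear_combination -(f x) * hx
  have him : ∀ f : L2 w, (stieltjes (fun t => f t * w t) z).im =
      -inner ℝ (h2.toLp _) f := fun f => by
    conv_lhs => rw [← Complex.re_add_im z, stieltjes_im (hint f) _ hz]
    rw [inner_L2_eq hw]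
    congr 1
    refine integral_congr_ae ?_
    filter_upwards [hw.mul_congr_ae h2.coeFn_toLp] with x hx
    linear_combination -(f x) * hx
  have heq : (fun f : L2 w => stieltjes (fun t => f t * w t) z) = fun f =>
      ((inner ℝ (h1.toLp _) f : ℝ) : ℂ) + ((-inner ℝ (h2.toLp _) f : ℝ) : ℂ) * Complex.I := by
    funext f
    rw [← hre, ← him, Complex.re_add_im]
  rw [heq]
  fun_prop

/-- Both sides are continuous in `f`, so the polynomial case suffices. Boundary values of this
identity give pointwise access to the class `T_ρ f`. -/
theorem stieltjes_opT (hρ : IsProbabilityDensity ρ) (hμ : IsSecondaryDensity ρ μ) (f : L2 ρ)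
    {z : ℂ} (hz : 0 < z.im) : stieltjes (fun t => f t * ρ t) z = stieltjes ρ z *
      ((inner ℝ f (polyL2 hρ.toIsDensity 1) : ℝ) +
        stieltjes (fun t => opT ρ μ f t * μ t) z) := by
  refine (denseRange_polyL2 hρ.toIsDensity).induction_on (p := fun f : L2 ρ =>
    stieltjes (fun t => f t * ρ t) z = stieltjes ρ z *
      ((inner ℝ f (polyL2 hρ.toIsDensity 1) : ℝ) +
        stieltjes (fun t => opT ρ μ f t * μ t) z)) f ?_ fun p => ?_
  · have h1 := continuous_stieltjes_L2 hρ.toIsDensity hz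
    have h2 := (continuous_stieltjes_L2 hμ.toIsDensity hz).comp (opT ρ μ).continuous
    simp only [Function.comp_def] at h2
    exact isClosed_eq h1 (by fun_prop)
  · rw [opT_polyL2 hρ hμ, inner_polyL2, mul_one,
      stieltjes_congr_ae (hρ.toIsDensity.mul_congr_ae (coeFn_polyL2 _ p)),
      stieltjes_congr_ae (hμ.toIsDensity.mul_congr_ae (coeFn_polyL2 _ _))]
    exact stieltjes_polynomial hρ hμ p hz

/-- Where the singular integral converges absolutely, it is a limit of truncated integrals. -/
theorem tendsto_truncated_secondary {f : ℝ → ℝ} {x : ℝ}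
    (h : IntegrableOn (fun t => (f t - f x) / (t - x) * ρ t) (Icc 0 1)) :
    Tendsto (fun ε : ℝ => ∫ t in Icc (0 : ℝ) 1,
      (x - t) * (f t * ρ t - f x * ρ t) / ((x - t) ^ 2 + ε ^ 2)) (𝓝[>] 0)
      (𝓝 (-secondary ρ f x)) := by
  -- The truncation multiplies the singular integrand by a factor in [0, 1] tending to 1 off t = x;
  -- at t = x both sides are 0.
  have heq : ∀ ε t : ℝ, 0 < ε → (x - t) * (f t * ρ t - f x * ρ t) / ((x - t) ^ 2 + ε ^ 2) =
      -((x - t) ^ 2 / ((x - t) ^ 2 + ε ^ 2) * ((f t - f x) / (t - x) * ρ t)) := by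
    intro ε t hε
    have h1 : (x - t) ^ 2 + ε ^ 2 ≠ 0 := by positivity
    rcases eq_or_ne t x with rfl | ht
    · simp
    · have := sub_ne_zero.2 ht
      field_simp
      ring
  have hmain : Tendsto (fun ε : ℝ => ∫ t in Icc (0 : ℝ) 1,
      (x - t) ^ 2 / ((x - t) ^ 2 + ε ^ 2) * ((f t - f x) / (t - x) * ρ t)) (𝓝[>] 0)
      (𝓝 (secondary ρ f x)) := by
    refine tendsto_integral_filter_of_dominated_convergence
      (fun t => ‖(f t - f x) / (t - x) * ρ t‖) ?_ ?_ h.norm ?_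
    · filter_upwards [self_mem_nhdsWithin] with ε hε
      have hε0 : 0 < ε := hε
      refine AEStronglyMeasurable.mul (Continuous.aestronglyMeasurable ?_) h.aestronglyMeasurable
      exact Continuous.div (by fun_prop) (by fun_prop) fun t => by positivity
    · filter_upwards [self_mem_nhdsWithin] with ε hε
      have hε0 : 0 < ε := hε
      refine ae_of_all _ fun t => ?_
      rw [norm_mul]
      refine mul_le_of_le_one_left (norm_nonneg _) ?_
      rw [Real.norm_of_nonneg (by positivity), div_le_one (by positivity)]
      exact le_add_of_nonneg_right (by positivity)
    · refine ae_of_all _ fun t => ?_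
      rcases eq_or_ne t x with rfl | ht
      · simp
      · have h0 : (x - t) ^ 2 ≠ 0 := pow_ne_zero 2 (sub_ne_zero.2 ht.symm)
        have h1 : Tendsto (fun ε : ℝ => (x - t) ^ 2 / ((x - t) ^ 2 + ε ^ 2)) (𝓝 0)
            (𝓝 ((x - t) ^ 2 / ((x - t) ^ 2 + 0 ^ 2))) :=
          ContinuousAt.div (by fun_prop) (by fun_prop) (by simpa using h0)
        rw [zero_pow two_ne_zero, add_zero, div_self h0] at h1
        simpa using (h1.mono_left nhdsWithin_le_nhds).mul_const ((f t - f x) / (t - x) * ρ t)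
  refine hmain.neg.congr' ?_
  filter_upwards [self_mem_nhdsWithin] with ε hε
  rw [← integral_neg]
  exact integral_congr_ae (ae_of_all _ fun t => (heq ε t hε).symm)

/-- Where the singular integral converges absolutely, it computes `T_ρ f`. -/
theorem IsReducer.ae_opT_eq_secondary (hρ : IsProbabilityDensity ρ)
    (hμ : IsSecondaryDensity ρ μ) (hφ : IsReducer ρ φ) (f : L2 ρ) :
    ∀ᵐ x ∂volume.restrict (Icc (0 : ℝ) 1), μ x ≠ 0 →
      IntegrableOn (fun t => (f t - f x) / (t - x) * ρ t) (Icc 0 1) →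
        opT ρ μ f x = secondary ρ f x := by
  have hfρ := hρ.toIsDensity.integrableOn_of_memLp (Lp.memLp f)
  have hhμ := hμ.toIsDensity.integrableOn_of_memLp (Lp.memLp (opT ρ μ f))
  filter_upwards [hφ.ae_tendsto_stieltjes hρ.toIsDensity, hφ.ae_boundaryValue_ne_zero hρ hμ,
    hφ.ae_mul_normSq hρ hμ, ae_tendsto_stieltjes_im hfρ, ae_tendsto_stieltjes_im hhμ]
    with x h1 h2 h3 h4 h5 hx hint
  set F := boundaryValue ρ φ x with hF
  set s := secondary ρ f x with hs
  have hN : Complex.normSq F ≠ 0 := by simpa using h2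
  -- Split S_{fρ} as f(x) S_ρ plus the transform of (f - f(x))ρ; the real part of the latter is the
  -- truncated integral, tending to -s.
  have hre : Tendsto (fun ε : ℝ => (stieltjes (fun t => f t * ρ t) (x + ε * Complex.I)).re)
      (𝓝[>] 0) (𝓝 (f x * F.re - s)) := by
    have h6 := (((Complex.continuous_re.tendsto _).comp h1).const_mul (f x)).add
      (tendsto_truncated_secondary hint)
    rw [← sub_eq_add_neg] at h6
    refine h6.congr' ?_
    filter_upwards [self_mem_nhdsWithin] with ε hε
    have hε0 : 0 < ε := hε
    have hz : 0 < ((x : ℂ) + ε * Complex.I).im := by simpa using hε0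
    have hfx : IntegrableOn (fun t => f t * ρ t - f x * ρ t) (Icc 0 1) :=
      hfρ.sub (hρ.integrable.const_mul (f x))
    have h7 := stieltjes_re hfx x hε0
    have h8 := stieltjes_add hfρ (hρ.integrable.const_mul (-f x)) hz
    rw [stieltjes_const_mul] at h8
    simp only [neg_mul, ← sub_eq_add_neg, Complex.ofReal_neg] at h8
    rw [← h7, h8, Function.comp_apply, Complex.sub_re, Complex.re_ofReal_mul]
    ring
  have hG : Tendsto (fun ε : ℝ => stieltjes (fun t => f t * ρ t) (x + ε * Complex.I))
      (𝓝[>] 0) (𝓝 (f x * F - s)) := by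
    have h6 := hre.ofReal.add (h4.ofReal.mul_const Complex.I)
    have h7 : ((f x * F.re - s : ℝ) : ℂ) + ((-(Real.pi * (f x * ρ x)) : ℝ) : ℂ) * Complex.I =
        f x * F - s := by
      apply Complex.ext <;> simp [hF, boundaryValue]
      ring
    refine (h7 ▸ h6).congr fun ε => ?_
    exact Complex.re_add_im _
  -- S_{fρ}/S_ρ is a real constant plus S_{T(f)μ}. It tends to f(x) - s/F, of imaginary part
  -- -πsμ(x), while Im S_{T(f)μ} tends to -πT(f)(x)μ(x).
  have hQ := (Complex.continuous_im.tendsto _).comp (hG.div h1 h2)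
  have h6 := tendsto_nhds_unique h5 (hQ.congr' ?_)
  · have h7 : (f x * F - s) / F = f x - s * F⁻¹ := by
      field_simp
    rw [h7, Complex.sub_im, Complex.ofReal_im, Complex.im_ofReal_mul, Complex.inv_im] at h6
    have h8 : F.im = -(Real.pi * ρ x) := rfl
    have h9 : -F.im / Complex.normSq F = Real.pi * μ x := by
      rw [h8, ← h3]
      field_simp
    rw [h9] at h6
    refine mul_right_cancel₀ (mul_ne_zero Real.pi_ne_zero hx) ?_
    linarith
  · filter_upwards [self_mem_nhdsWithin] with ε hε
    have hz : 0 < ((x : ℂ) + ε * Complex.I).im := by simpa using hε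
    rw [Function.comp_apply, Pi.div_apply, stieltjes_opT hρ hμ f hz,
      mul_div_cancel_left₀ _ (hρ.stieltjes_ne_zero hz), Complex.add_im, Complex.ofReal_im, zero_add]

end OperatorT

/-! ### Densities with the same null sets, and multiplication operators -/

section Multiplication

variable {w v m : ℝ → ℝ}

theorem IsDensity.ae_eq_ae (hw : IsDensity w) (hv : IsDensity v)
    (h : ∀ᵐ x ∂volume.restrict (Icc (0 : ℝ) 1), w x = 0 ↔ v x = 0) :
    ae (densMeasure w) = ae (densMeasure v) := by
  ext s
  change (∀ᵐ x ∂densMeasure w, x ∈ s) ↔ ∀ᵐ x ∂densMeasure v, x ∈ s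
  rw [hw.ae_iff, hv.ae_iff]
  refine eventually_congr ?_
  filter_upwards [h] with x hx
  rw [Ne, hx]

theorem IsDensity.memLp_mul (hw : IsDensity w) (hv : IsDensity v)
    (h : ae (densMeasure w) = ae (densMeasure v))
    (hm : AEStronglyMeasurable m (volume.restrict (Icc (0 : ℝ) 1)))
    (hmw : ∀ᵐ x ∂volume.restrict (Icc (0 : ℝ) 1), m x ^ 2 * v x = w x) {f : ℝ → ℝ}
    (hf : MemLp f 2 (densMeasure w)) : MemLp (fun x => m x * f x) 2 (densMeasure v) := by
  have hac : densMeasure v ≪ densMeasure w := Measure.ae_le_iff_absolutelyContinuous.1 h.ge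
  refine (memLp_two_iff_integrable_sq ((hm.mono_ac (densMeasure_absolutelyContinuous v)).mul
    (hf.aestronglyMeasurable.mono_ac hac))).2 ?_
  rw [hv.integrable_iff]
  refine (hw.integrable_iff.1 hf.integrable_sq).congr ?_
  filter_upwards [hmw] with x hx
  rw [← hx, Pi.mul_apply]
  ring

theorem IsDensity.norm_toLp_mul (hw : IsDensity w) (hv : IsDensity v)
    (hmw : ∀ᵐ x ∂volume.restrict (Icc (0 : ℝ) 1), m x ^ 2 * v x = w x) (f : L2 w)
    (hmf : MemLp (fun x => m x * f x) 2 (densMeasure v)) :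
    ‖hmf.toLp _‖ = ‖f‖ := by
  refine (sq_eq_sq₀ (norm_nonneg _) (norm_nonneg _)).1 ?_
  rw [← real_inner_self_eq_norm_sq, ← real_inner_self_eq_norm_sq, inner_toLp_toLp hv hmf hmf,
    inner_L2_eq hw]
  refine integral_congr_ae ?_
  filter_upwards [hmw] with x hx
  simp only [← hx]
  ring

/-- Fubini for the kernel u/(u² + ε²), which is odd in u = x - t and bounded for fixed ε. -/
theorem integral_mul_stieltjes_re {a b : ℝ → ℝ} (ha : IntegrableOn a (Icc 0 1))
    (hb : IntegrableOn b (Icc 0 1)) {ε : ℝ} (hε : 0 < ε) :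
    ∫ x in Icc (0 : ℝ) 1, a x * (stieltjes b (x + ε * Complex.I)).re =
      -∫ x in Icc (0 : ℝ) 1, b x * (stieltjes a (x + ε * Complex.I)).re := by
  have hint : Integrable (fun z : ℝ × ℝ => a z.1 * ((z.1 - z.2) * b z.2 /
      ((z.1 - z.2) ^ 2 + ε ^ 2)))
      ((volume.restrict (Icc (0 : ℝ) 1)).prod (volume.restrict (Icc (0 : ℝ) 1))) := by
    have h1 := (Integrable.mul_prod ha hb).mul_bdd (c := ε⁻¹)
      (g := fun z : ℝ × ℝ => (z.1 - z.2) / ((z.1 - z.2) ^ 2 + ε ^ 2)) ?_ (ae_of_all _ fun z => ?_)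
    · refine h1.congr (ae_of_all _ fun z => ?_)
      simp only
      ring
    · refine Continuous.aestronglyMeasurable ?_
      exact Continuous.div (by fun_prop) (by fun_prop) fun z => by positivity
    · have h0 : 0 < (z.1 - z.2) ^ 2 + ε ^ 2 := by positivity
      rw [norm_div, Real.norm_eq_abs, Real.norm_of_nonneg h0.le, div_le_iff₀ h0,
        inv_mul_eq_div, le_div_iff₀ hε]
      nlinarith [sq_abs (z.1 - z.2), sq_nonneg (|z.1 - z.2| - ε), sq_nonneg ε,
        abs_nonneg (z.1 - z.2)]
  simp only [stieltjes_re ha _ hε, stieltjes_re hb _ hε, ← integral_const_mul, ← integral_neg]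
  rw [integral_integral_swap hint]
  refine integral_congr_ae (ae_of_all _ fun t => integral_congr_ae (ae_of_all _ fun x => ?_))
  simp only
  rw [show (x - t) ^ 2 = (t - x) ^ 2 by ring]
  ring

end Multiplication

/-! ### Consequences of reducibility -/

section Reducible

variable {ρ μ φ : ℝ → ℝ}

theorem contDiff_eval (p : ℝ[X]) (n : WithTop ℕ∞) : ContDiff ℝ n fun x : ℝ => p.eval x := by
  simpa using p.contDiff_aeval (𝕜 := ℝ) (R := ℝ) n

theorem continuous_stieltjes_re {w : ℝ → ℝ} (hw : IntegrableOn w (Icc 0 1)) {ε : ℝ} (hε : 0 < ε) :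
    Continuous fun x : ℝ => (stieltjes w (x + ε * Complex.I)).re := by
  refine Complex.continuous_re.comp (continuous_iff_continuousAt.2 fun x => ?_)
  have hz : 0 < ((x : ℂ) + ε * Complex.I).im := by simpa using hε
  exact ContinuousAt.comp (f := fun x : ℝ => (x : ℂ) + ε * Complex.I)
    (differentiableAt_stieltjes hw hz).continuousAt (by fun_prop)

theorem continuous_reducerApprox (hρ : IsDensity ρ) {ε : ℝ} (hε : 0 < ε) :
    Continuous (reducerApprox ρ ε) := by
  rw [show reducerApprox ρ ε = fun x : ℝ => 2 * (stieltjes ρ (x + ε * Complex.I)).re from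
    funext fun x => reducerApprox_eq hρ.integrable x hε]
  exact (continuous_stieltjes_re hρ.integrable hε).const_mul 2

/-- The definition of the reducer does not include measurability; it follows because φ is an almost
everywhere limit of continuous functions. -/
theorem IsReducer.aestronglyMeasurable (hρ : IsDensity ρ) (hφ : IsReducer ρ φ) :
    AEStronglyMeasurable φ (volume.restrict (Icc (0 : ℝ) 1)) := by
  have hlim : Tendsto (fun n : ℕ => 1 / ((n : ℝ) + 1)) atTop (𝓝[>] 0) :=
    tendsto_nhdsWithin_iff.2 ⟨tendsto_one_div_add_atTop_nhds_zero_nat,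
      Eventually.of_forall fun n => by simp only [mem_Ioi]; positivity⟩
  refine aestronglyMeasurable_of_tendsto_ae atTop
    (f := fun (n : ℕ) x => reducerApprox ρ (1 / ((n : ℝ) + 1)) x) (fun n => ?_) ?_
  · exact (continuous_reducerApprox hρ (by positivity)).aestronglyMeasurable
  · filter_upwards [hφ.ae_restrict] with x hx using hx.comp hlim

theorem IsReducible.memLp_sub (hρ : IsDensity ρ) (hred : IsReducible ρ μ φ) :
    ∀ᶠ ε in 𝓝[>] (0 : ℝ), MemLp (fun x => reducerApprox ρ ε x - φ x) 2 (densMeasure ρ) := by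
  filter_upwards [self_mem_nhdsWithin, hred.tendsto_L2.eventually_lt_const one_pos] with ε hε h
  refine ⟨?_, h.trans ENNReal.one_lt_top⟩
  exact ((continuous_reducerApprox hρ hε).aestronglyMeasurable.sub
    (hred.isReducer.aestronglyMeasurable hρ)).mono_ac (densMeasure_absolutelyContinuous ρ)

theorem IsReducible.memLp_reducer (hρ : IsDensity ρ) (hred : IsReducible ρ μ φ) :
    MemLp φ 2 (densMeasure ρ) := by
  obtain ⟨ε, h1, hε⟩ := ((hred.memLp_sub hρ).and self_mem_nhdsWithin).exists
  have h2 : MemLp (reducerApprox ρ ε) 2 (densMeasure ρ) :=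
    hρ.memLp_of_continuousOn (continuous_reducerApprox hρ hε).continuousOn
  refine (h2.sub h1).ae_eq (ae_of_all _ fun x => ?_)
  simp

/-- As `T_ρ` is onto L²(μ), the range condition amounts to this membership, which makes ρ²/μ
integrable. -/
theorem IsReducible.memLp_quotient (hred : IsReducible ρ μ φ) :
    MemLp (fun x => ρ x / μ x) 2 (densMeasure μ) := by
  obtain ⟨f, hf⟩ := hred.quotient_mem_range
  exact (Lp.memLp (opT ρ μ f)).ae_eq hf

theorem quotDensity_eq (ρ μ : ℝ → ℝ) (x : ℝ) : (ρ x / μ x) ^ 2 * μ x = quotDensity ρ μ x := by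
  rw [quotDensity]
  by_cases h : μ x = 0
  · simp [h]
  · field_simp

theorem IsReducible.isDensity_quotDensity (hμ : IsDensity μ) (hred : IsReducible ρ μ φ) :
    IsDensity (quotDensity ρ μ) := by
  refine ⟨fun x hx => div_nonneg (sq_nonneg _) (hμ.nonneg x hx), ?_⟩
  refine (hμ.integrable_iff.1 hred.memLp_quotient.integrable_sq).congr (ae_of_all _ fun x => ?_)
  exact quotDensity_eq ρ μ x

theorem IsReducible.ae_eq_ae_left (hρ : IsProbabilityDensity ρ)
    (hμ : IsSecondaryDensity ρ μ) (hred : IsReducible ρ μ φ) :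
    ae (densMeasure μ) = ae (densMeasure ρ) :=
  hμ.toIsDensity.ae_eq_ae hρ.toIsDensity (hred.isReducer.ae_eq_zero_iff hρ hμ)

theorem IsReducible.ae_eq_ae_right (hρ : IsProbabilityDensity ρ)
    (hμ : IsSecondaryDensity ρ μ) (hred : IsReducible ρ μ φ) :
    ae (densMeasure μ) = ae (densMeasure (quotDensity ρ μ)) := by
  refine hμ.toIsDensity.ae_eq_ae (hred.isDensity_quotDensity hμ.toIsDensity) ?_
  filter_upwards [hred.isReducer.ae_eq_zero_iff hρ hμ] with x hx
  simp only [quotDensity, div_eq_zero_iff, pow_eq_zero_iff two_ne_zero]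
  tauto

/-- `∫ φ f ρ = ∫ T_ρ(f) ρ` for a polynomial `f`. -/
theorem IsReducible.integral_reducer_mul (hρ : IsProbabilityDensity ρ)
    (hred : IsReducible ρ μ φ) (p : ℝ[X]) :
    ∫ x in Icc (0 : ℝ) 1, φ x * p.eval x * ρ x =
      polyIntegral hρ.toIsDensity (secPoly hρ.toIsDensity p) := by
  have hρ' := hρ.toIsDensity
  have := hρ'.isFiniteMeasure
  have hpρ := hρ'.integrableOn_of_memLp (hρ'.memLp_polynomial p)
  have hφ := hred.memLp_reducer hρ'
  have hra : ∀ ε, 0 < ε → MemLp (reducerApprox ρ ε) 2 (densMeasure ρ) := fun ε hε =>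
    hρ'.memLp_of_continuousOn (continuous_reducerApprox hρ' hε).continuousOn
  have h1 : Tendsto (fun ε => ∫ x in Icc (0 : ℝ) 1, reducerApprox ρ ε x * p.eval x * ρ x)
      (𝓝[>] 0) (𝓝 (∫ x in Icc (0 : ℝ) 1, φ x * p.eval x * ρ x)) := by
    rw [tendsto_iff_norm_sub_tendsto_zero]
    have h2 := ((ENNReal.tendsto_toReal ENNReal.zero_ne_top).comp hred.tendsto_L2).mul_const
      ‖polyL2 hρ' p‖
    rw [ENNReal.toReal_zero, zero_mul] at h2
    refine squeeze_zero' (Eventually.of_forall fun ε => norm_nonneg _) ?_ h2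
    filter_upwards [hred.memLp_sub hρ', self_mem_nhdsWithin] with ε h3 hε
    have h4 := norm_inner_le_norm (𝕜 := ℝ) (h3.toLp _) (polyL2 hρ' p)
    rw [Lp.norm_toLp] at h4
    refine le_trans (le_of_eq ?_) h4
    congr 1
    rw [← integral_sub (hρ'.integrableOn_mul (hra ε hε) (hρ'.memLp_polynomial p))
      (hρ'.integrableOn_mul hφ (hρ'.memLp_polynomial p))]
    refine Eq.trans ?_ (inner_toLp_toLp hρ' h3 (hρ'.memLp_polynomial p)).symm
    refine integral_congr_ae (ae_of_all _ fun x => ?_)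
    simp only
    ring
  obtain ⟨K, hK⟩ := (contDiff_eval p 1).contDiffOn.exists_lipschitzOnWith one_ne_zero
    (convex_Icc (0 : ℝ) 1) isCompact_Icc
  -- `J ε x` is the truncated singular integral of p, which tends to -T(p)(x) and is bounded by a
  -- Lipschitz constant of p.
  set J : ℝ → ℝ → ℝ := fun ε x => (stieltjes (fun t => p.eval t * ρ t) (x + ε * Complex.I)).re -
    p.eval x * (stieltjes ρ (x + ε * Complex.I)).re with hJ
  have hJeq : ∀ ε x, 0 < ε → J ε x = ∫ t in Icc (0 : ℝ) 1,
      (x - t) * (p.eval t * ρ t - p.eval x * ρ t) / ((x - t) ^ 2 + ε ^ 2) := by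
    intro ε x hε
    have hz : 0 < ((x : ℂ) + ε * Complex.I).im := by simpa using hε
    have h5 : IntegrableOn (fun t => p.eval t * ρ t - p.eval x * ρ t) (Icc 0 1) :=
      hpρ.sub (hρ.integrable.const_mul (p.eval x))
    have h6 := stieltjes_add hpρ (hρ.integrable.const_mul (-p.eval x)) hz
    rw [stieltjes_const_mul] at h6
    simp only [neg_mul, ← sub_eq_add_neg, Complex.ofReal_neg] at h6
    rw [← stieltjes_re h5 x hε, h6, Complex.sub_re, Complex.re_ofReal_mul]
  have h2 : Tendsto (fun ε => ∫ x in Icc (0 : ℝ) 1, -J ε x * ρ x) (𝓝[>] 0)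
      (𝓝 (∫ x in Icc (0 : ℝ) 1, (secPoly hρ' p).eval x * ρ x)) := by
    refine tendsto_integral_filter_of_dominated_convergence (fun x => K * ‖ρ x‖) ?_ ?_
      (hρ.integrable.norm.const_mul _) ?_
    · filter_upwards [self_mem_nhdsWithin] with ε hε
      refine AEStronglyMeasurable.mul (Continuous.aestronglyMeasurable ?_)
        hρ.integrable.aestronglyMeasurable
      have h3 := continuous_stieltjes_re hpρ hε
      have h4 := continuous_stieltjes_re hρ.integrable hε
      exact (h3.sub (p.continuous.mul h4)).neg
    · filter_upwards [self_mem_nhdsWithin] with ε hε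
      have hε0 : 0 < ε := hε
      filter_upwards [ae_restrict_mem measurableSet_Icc] with x hx
      rw [norm_mul, norm_neg]
      gcongr
      rw [hJeq ε x hε]
      have h3 : ‖∫ t in Icc (0 : ℝ) 1, (x - t) * (p.eval t * ρ t - p.eval x * ρ t) /
          ((x - t) ^ 2 + ε ^ 2)‖ ≤ ∫ t in Icc (0 : ℝ) 1, K * ρ t := by
        refine norm_integral_le_of_norm_le (hρ.integrable.const_mul _) ?_
        filter_upwards [ae_restrict_mem measurableSet_Icc] with t ht
        have h4 := hK.dist_le_mul t ht x hx
        rw [Real.dist_eq, Real.dist_eq, abs_sub_comm t x] at h4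
        have h5 := hρ.nonneg t ht
        rw [← sub_mul, norm_div, norm_mul, norm_mul, Real.norm_of_nonneg h5,
          Real.norm_of_nonneg (by positivity : 0 ≤ (x - t) ^ 2 + ε ^ 2), div_le_iff₀ (by positivity),
          Real.norm_eq_abs, Real.norm_eq_abs]
        calc _ ≤ |x - t| * (K * |x - t| * ρ t) := by gcongr
          _ = K * ρ t * (x - t) ^ 2 := by rw [← sq_abs]; ring
          _ ≤ _ := by gcongr; nlinarith
      rwa [integral_const_mul, hρ.integral_eq_one, mul_one] at h3
    · refine ae_of_all _ fun x => ?_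
      have h3 := tendsto_truncated_secondary (eval_secPoly hρ' p x).2
      rw [(eval_secPoly hρ' p x).1] at h3
      have h4 := (h3.neg.mul_const (ρ x))
      rw [neg_neg] at h4
      refine h4.congr' ?_
      filter_upwards [self_mem_nhdsWithin] with ε hε
      rw [hJeq ε x hε]
  refine tendsto_nhds_unique h1 (h2.congr' ?_)
  filter_upwards [self_mem_nhdsWithin] with ε hε
  have hε0 : 0 < ε := hε
  have hcb : ∀ {a b : ℝ → ℝ}, Continuous b → IntegrableOn a (Icc 0 1) →
      IntegrableOn (fun x => a x * b x) (Icc 0 1) := fun hb ha =>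
    ha.mul_continuousOn hb.continuousOn isCompact_Icc
  have i1 := hcb (continuous_stieltjes_re hpρ hε) hρ.integrable
  have i2 := hcb (continuous_stieltjes_re hρ.integrable hε) hpρ
  -- Antisymmetry doubles the term ∫ p ρ Re S_ρ in -∫Jρ; this is where the factor 2 in φ_ε comes
  -- from.
  have h3 := integral_mul_stieltjes_re hρ.integrable hpρ hε0
  calc ∫ x in Icc (0 : ℝ) 1, -J ε x * ρ x
      = ∫ x in Icc (0 : ℝ) 1, (p.eval x * ρ x * (stieltjes ρ (x + ε * Complex.I)).re -
          ρ x * (stieltjes (fun t => p.eval t * ρ t) (x + ε * Complex.I)).re) := by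
        refine integral_congr_ae (ae_of_all _ fun x => ?_)
        simp only [hJ]
        ring
    _ = 2 * ∫ x in Icc (0 : ℝ) 1, p.eval x * ρ x * (stieltjes ρ (x + ε * Complex.I)).re := by
        rw [integral_sub i2 i1, h3]
        ring
    _ = _ := by
        rw [← integral_const_mul]
        refine integral_congr_ae (ae_of_all _ fun x => ?_)
        simp only [reducerApprox_eq hρ.integrable x hε0]
        ring

end Reducible

/-! ### The operator `U_ρ` -/

section OperatorU

variable {ρ μ φ : ℝ → ℝ}

theorem MemLp.mul_polynomial {w f : ℝ → ℝ} (hw : IsDensity w) (hf : MemLp f 2 (densMeasure w))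
    (p : ℝ[X]) : MemLp (fun x => f x * p.eval x) 2 (densMeasure w) :=
  (hw.memLp_polynomial p (q := ⊤)).mul' hf

theorem ae_restrict_quotient_mul (hρ : IsProbabilityDensity ρ)
    (hμ : IsSecondaryDensity ρ μ) (hred : IsReducible ρ μ φ) :
    ∀ᵐ x ∂volume.restrict (Icc (0 : ℝ) 1), ρ x / μ x * μ x = ρ x := by
  filter_upwards [hred.isReducer.ae_eq_zero_iff hρ hμ] with x hx
  by_cases h : μ x = 0
  · simp [h, hx.1 h]
  · field_simp

/-- `∫ φ r k ρ - ∫ r T_ρ(k) ρ = ∫ k T_ρ(r) ρ` for `k ∈ L²(ρ)` and a polynomial `r`. -/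
theorem IsReducible.integral_mul_opT (hρ : IsProbabilityDensity ρ)
    (hμ : IsSecondaryDensity ρ μ) (hred : IsReducible ρ μ φ) (r : ℝ[X]) (k : L2 ρ) :
    (∫ x in Icc (0 : ℝ) 1, φ x * r.eval x * k x * ρ x) -
      ∫ x in Icc (0 : ℝ) 1, r.eval x * opT ρ μ k x * ρ x =
      ∫ x in Icc (0 : ℝ) 1, (secPoly hρ.toIsDensity r).eval x * k x * ρ x := by
  have hρ' := hρ.toIsDensity
  have hμ' := hμ.toIsDensity
  -- Pairing with φr in L²(ρ) and with (ρ/μ)r in L²(μ) makes every term continuous in k, so k may be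
  -- taken to be a polynomial.
  have ha := MemLp.mul_polynomial hρ' (hred.memLp_reducer hρ') r
  have hb := MemLp.mul_polynomial hμ' hred.memLp_quotient r
  have hquot := ae_restrict_quotient_mul hρ hμ hred
  have ea : ∀ k : L2 ρ, inner ℝ (ha.toLp _) k =
      ∫ x in Icc (0 : ℝ) 1, φ x * r.eval x * k x * ρ x := fun k => by
    rw [inner_L2_eq hρ']
    refine integral_congr_ae ?_
    filter_upwards [hρ'.mul_congr_ae ha.coeFn_toLp] with x hx
    linear_combination (k x) * hx
  have eb : ∀ h : L2 μ, inner ℝ (hb.toLp _) h =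
      ∫ x in Icc (0 : ℝ) 1, r.eval x * h x * ρ x := fun h => by
    rw [inner_L2_eq hμ']
    refine integral_congr_ae ?_
    filter_upwards [hμ'.mul_congr_ae hb.coeFn_toLp, hquot] with x hx hq
    linear_combination (h x) * hx + r.eval x * h x * hq
  have ec : ∀ k : L2 ρ, inner ℝ (polyL2 hρ' (secPoly hρ' r)) k =
      ∫ x in Icc (0 : ℝ) 1, (secPoly hρ.toIsDensity r).eval x * k x * ρ x := fun k => by
    rw [inner_L2_eq hρ']
    refine integral_congr_ae ?_
    filter_upwards [hρ'.mul_congr_ae (coeFn_polyL2 hρ' (secPoly hρ' r))] with x hx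
    linear_combination (k x) * hx
  rw [← ea, ← eb, ← ec]
  refine (denseRange_polyL2 hρ').induction_on (p := fun k : L2 ρ =>
    inner ℝ (ha.toLp _) k - inner ℝ (hb.toLp _) (opT ρ μ k) =
      inner ℝ (polyL2 hρ' (secPoly hρ' r)) k) k ?_ fun p => ?_
  · exact isClosed_eq (by fun_prop) (by fun_prop)
  · have h1 := hred.integral_reducer_mul hρ (p * r)
    rw [polyIntegral_secPoly_mul] at h1
    rw [opT_polyL2 hρ hμ, ea, eb, inner_polyL2, mul_comm (secPoly hρ' r)]
    have h2 : ∫ x in Icc (0 : ℝ) 1, φ x * r.eval x * polyL2 hρ' p x * ρ x =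
        ∫ x in Icc (0 : ℝ) 1, φ x * (p * r).eval x * ρ x := by
      refine integral_congr_ae ?_
      filter_upwards [hρ'.mul_congr_ae (coeFn_polyL2 hρ' p)] with x hx
      rw [eval_mul]
      linear_combination φ x * r.eval x * hx
    have h3 : ∫ x in Icc (0 : ℝ) 1, r.eval x * polyL2 hμ' (secPoly hρ' p) x * ρ x =
        polyIntegral hρ' (r * secPoly hρ' p) := by
      rw [polyIntegral_apply]
      refine integral_congr_ae ?_
      filter_upwards [hμ'.mul_congr_ae (coeFn_polyL2 hμ' (secPoly hρ' p)), hquot] with x hx hq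
      rw [eval_mul, ← hq]
      linear_combination r.eval x * (ρ x / μ x) * hx
    rw [h2, h3, h1]
    ring

/-- The solution of `T_ρ(y) = (ρ / μ) k` is `φ k - T_ρ(k)`. -/
theorem IsReducible.eq_reducer_mul_sub (hρ : IsProbabilityDensity ρ)
    (hμ : IsSecondaryDensity ρ μ) (hred : IsReducible ρ μ φ) {y k : L2 ρ}
    (hy : y ∈ hyperplane ρ) (hk : k =ᵐ[densMeasure ρ] fun x => μ x / ρ x * opT ρ μ y x)
    (hφk : MemLp (fun x => φ x * k x) 2 (densMeasure ρ))
    (hTk : MemLp (opT ρ μ k) 2 (densMeasure ρ)) :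
    y =ᵐ[densMeasure ρ] fun x => φ x * k x - opT ρ μ k x := by
  have hρ' := hρ.toIsDensity
  have hμ' := hμ.toIsDensity
  have hf := hφk.sub hTk
  suffices hyf : y = hf.toLp _ by
    rw [hyf]
    exact hf.coeFn_toLp
  refine ext_inner_right ℝ fun v => ?_
  refine (denseRange_polyL2 hρ').induction_on
    (p := fun v : L2 ρ => inner ℝ y v = inner ℝ (hf.toLp _) v) v ?_ fun r => ?_
  · exact isClosed_eq (by fun_prop) (by fun_prop)
  -- On H_ρ the isometry turns ⟨y, r⟩ into ∫ T(y) T(r) μ, and μT(y) = ρk; `integral_mul_opT` then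
  -- moves T off r.
  have h1 := inner_opT hρ hμ y (polyL2 hρ' r)
  rw [(mem_hyperplane_iff hρ').1 hy, zero_mul, sub_zero, opT_polyL2 hρ hμ, inner_L2_eq hμ'] at h1
  have hr := hρ'.memLp_polynomial r (q := 2)
  have i1 : IntegrableOn (fun x => φ x * r.eval x * k x * ρ x) (Icc 0 1) := by
    refine (hρ'.integrableOn_mul hφk hr).congr (ae_of_all _ fun x => ?_)
    simp only
    ring
  have i2 : IntegrableOn (fun x => r.eval x * opT ρ μ k x * ρ x) (Icc 0 1) :=
    hρ'.integrableOn_mul hr hTk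
  have h2 : inner ℝ (hf.toLp _) (polyL2 hρ' r) =
      ∫ x in Icc (0 : ℝ) 1, (φ x * r.eval x * k x * ρ x - r.eval x * opT ρ μ k x * ρ x) := by
    refine (inner_toLp_toLp hρ' hf hr).trans (integral_congr_ae (ae_of_all _ fun x => ?_))
    simp only [Pi.sub_apply]
    ring
  rw [← h1, h2, integral_sub i1 i2, hred.integral_mul_opT hρ hμ r k]
  refine integral_congr_ae ?_
  filter_upwards [hρ'.mul_congr_ae hk, hμ'.mul_congr_ae (coeFn_polyL2 hμ' (secPoly hρ' r)),
    hred.isReducer.ae_eq_zero_iff hρ hμ] with x h3 h4 h5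
  have h6 : μ x / ρ x * ρ x = μ x := by
    by_cases h : ρ x = 0
    · simp [h, h5.2 h]
    · field_simp
  linear_combination opT ρ μ y x * h4 - (secPoly hρ' r).eval x * h3 -
    (secPoly hρ' r).eval x * opT ρ μ y x * h6

theorem IsReducible.memLp_F (hρ : IsProbabilityDensity ρ) (hμ : IsSecondaryDensity ρ μ)
    (hred : IsReducible ρ μ φ) {g : ℝ → ℝ} (hg : MemLp g 2 (densMeasure μ)) :
    MemLp (fun x => μ x / ρ x * g x) 2 (densMeasure (quotDensity ρ μ)) := by
  refine hμ.toIsDensity.memLp_mul (hred.isDensity_quotDensity hμ.toIsDensity)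
    (hred.ae_eq_ae_right hρ hμ) ?_ ?_ hg
  · exact (hμ.integrable.aestronglyMeasurable.aemeasurable.div
      hρ.integrable.aestronglyMeasurable.aemeasurable).aestronglyMeasurable
  · filter_upwards [hred.isReducer.ae_eq_zero_iff hρ hμ] with x hx
    rw [quotDensity]
    by_cases h : μ x = 0
    · simp [h]
    · have := fun h0 => h (hx.2 h0)
      field_simp

theorem IsReducible.memLp_F_symm (hρ : IsProbabilityDensity ρ) (hμ : IsSecondaryDensity ρ μ)
    (hred : IsReducible ρ μ φ) {h : ℝ → ℝ} (hh : MemLp h 2 (densMeasure (quotDensity ρ μ))) :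
    MemLp (fun x => ρ x / μ x * h x) 2 (densMeasure μ) := by
  refine (hred.isDensity_quotDensity hμ.toIsDensity).memLp_mul hμ.toIsDensity
    (hred.ae_eq_ae_right hρ hμ).symm ?_ ?_ hh
  · exact (hρ.integrable.aestronglyMeasurable.aemeasurable.div
      hμ.integrable.aestronglyMeasurable.aemeasurable).aestronglyMeasurable
  · exact ae_of_all _ fun x => quotDensity_eq ρ μ x

theorem IsReducible.coeFn_opF (hρ : IsProbabilityDensity ρ) (hμ : IsSecondaryDensity ρ μ)
    (hred : IsReducible ρ μ φ) (g : L2 μ) :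
    opF ρ μ g =ᵐ[densMeasure (quotDensity ρ μ)] fun x => μ x / ρ x * g x := by
  have h := hred.memLp_F hρ hμ (Lp.memLp g)
  rw [opF, dif_pos h]
  exact h.coeFn_toLp

/-- Multiplication by `ρ / μ`, the inverse of `F_{(μ, ρ)}`. -/
noncomputable def opFSymm (hρ : IsProbabilityDensity ρ) (hμ : IsSecondaryDensity ρ μ)
    (hred : IsReducible ρ μ φ) : L2 (quotDensity ρ μ) →ₗᵢ[ℝ] L2 μ where
  toFun h := (hred.memLp_F_symm hρ hμ (Lp.memLp h)).toLp _
  map_add' f g := by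
    rw [← MemLp.toLp_add]
    refine MemLp.toLp_congr _ _ ?_
    have h := Lp.coeFn_add f g
    rw [Filter.EventuallyEq, ← hred.ae_eq_ae_right hρ hμ] at h
    filter_upwards [h] with x hx
    simp only [hx, Pi.add_apply]
    ring
  map_smul' c f := by
    rw [RingHom.id_apply, ← MemLp.toLp_const_smul]
    refine MemLp.toLp_congr _ _ ?_
    have h := Lp.coeFn_smul c f
    rw [Filter.EventuallyEq, ← hred.ae_eq_ae_right hρ hμ] at h
    filter_upwards [h] with x hx
    simp only [hx, Pi.smul_apply, smul_eq_mul]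
    ring
  norm_map' f := (hred.isDensity_quotDensity hμ.toIsDensity).norm_toLp_mul hμ.toIsDensity
    (ae_of_all _ fun x => quotDensity_eq ρ μ x) f
      (hred.memLp_F_symm hρ hμ (Lp.memLp f))

theorem coeFn_opFSymm (hρ : IsProbabilityDensity ρ) (hμ : IsSecondaryDensity ρ μ)
    (hred : IsReducible ρ μ φ) (h : L2 (quotDensity ρ μ)) :
    opFSymm hρ hμ hred h =ᵐ[densMeasure μ] fun x => ρ x / μ x * h x :=
  MemLp.coeFn_toLp (hred.memLp_F_symm hρ hμ (Lp.memLp h))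

theorem IsReducible.ae_ne_zero (hρ : IsProbabilityDensity ρ)
    (hμ : IsSecondaryDensity ρ μ) (hred : IsReducible ρ μ φ) :
    ∀ᵐ x ∂densMeasure μ, μ x ≠ 0 ∧ ρ x ≠ 0 := by
  rw [hμ.toIsDensity.ae_iff]
  filter_upwards [hred.isReducer.ae_eq_zero_iff hρ hμ] with x hx h
  exact ⟨h, fun h0 => h (hx.2 h0)⟩

theorem opF_opFSymm (hρ : IsProbabilityDensity ρ) (hμ : IsSecondaryDensity ρ μ)
    (hred : IsReducible ρ μ φ) (h : L2 (quotDensity ρ μ)) :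
    opF ρ μ (opFSymm hρ hμ hred h) = h := by
  refine Lp.ext ((hred.coeFn_opF hρ hμ _).trans ?_)
  rw [Filter.EventuallyEq, ← hred.ae_eq_ae_right hρ hμ]
  filter_upwards [coeFn_opFSymm hρ hμ hred h, hred.ae_ne_zero hρ hμ] with x h1 h2
  obtain ⟨h3, h4⟩ := h2
  rw [h1]
  field_simp

theorem opFSymm_opF (hρ : IsProbabilityDensity ρ) (hμ : IsSecondaryDensity ρ μ)
    (hred : IsReducible ρ μ φ) (g : L2 μ) : opFSymm hρ hμ hred (opF ρ μ g) = g := by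
  refine Lp.ext ((coeFn_opFSymm hρ hμ hred _).trans ?_)
  have h1 := hred.coeFn_opF hρ hμ g
  rw [Filter.EventuallyEq, ← hred.ae_eq_ae_right hρ hμ] at h1
  filter_upwards [h1, hred.ae_ne_zero hρ hμ] with x h1 h2
  obtain ⟨h3, h4⟩ := h2
  rw [h1]
  field_simp

/-- A continuous `U` with `T_ρ ∘ U` the multiplication by `ρ / μ`. -/
theorem exists_opTRestrict_comp (hρ : IsProbabilityDensity ρ) (hμ : IsSecondaryDensity ρ μ)
    (hred : IsReducible ρ μ φ) : ∃ U : L2 (quotDensity ρ μ) →L[ℝ] hyperplane ρ,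
      ∀ h, opTRestrict ρ μ (U h) = opFSymm hρ hμ hred h := by
  let Ti : hyperplane ρ →ₗᵢ[ℝ] L2 μ :=
    ⟨(opTRestrict ρ μ).toLinearMap, fun f => by
      simpa using (isometry_opTRestrict hρ hμ).norm_map_of_map_zero (map_zero _) f⟩
  let Te := LinearIsometryEquiv.ofSurjective Ti (surjective_opTRestrict hρ hμ)
  refine ⟨Te.symm.toContinuousLinearEquiv.toContinuousLinearMap ∘L
    (opFSymm hρ hμ hred).toContinuousLinearMap, fun h => ?_⟩
  exact Te.apply_symm_apply _

/-- For f = p the element y = U(f) of H_ρ satisfies T(y) = (ρ/μ)p, so the formula φk - T(k) applies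
with k = p. -/
theorem extendsU_of_comp (hρ : IsProbabilityDensity ρ) (hμ : IsSecondaryDensity ρ μ)
    (hred : IsReducible ρ μ φ) {U : L2 (quotDensity ρ μ) →L[ℝ] hyperplane ρ}
    (hU : ∀ h, opTRestrict ρ μ (U h) = opFSymm hρ hμ hred h) : ExtendsU ρ μ φ U := by
  intro p f hf
  have hρ' := hρ.toIsDensity
  have hμ' := hμ.toIsDensity
  have hT : opT ρ μ (U f) = opFSymm hρ hμ hred f := hU f
  have hp := coeFn_polyL2 hρ' p
  have hTp := coeFn_polyL2 hμ' (secPoly hρ' p)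
  rw [← opT_polyL2 hρ hμ, Filter.EventuallyEq, hred.ae_eq_ae_left hρ hμ] at hTp
  have hk : polyL2 hρ' p =ᵐ[densMeasure ρ] fun x => μ x / ρ x * opT ρ μ (U f) x := by
    have h1 := coeFn_opFSymm hρ hμ hred f
    have h2 := hred.ae_ne_zero hρ hμ
    rw [Filter.EventuallyEq, ← hred.ae_eq_ae_right hρ hμ, hred.ae_eq_ae_left hρ hμ] at hf
    rw [← hT, Filter.EventuallyEq, hred.ae_eq_ae_left hρ hμ] at h1
    rw [hred.ae_eq_ae_left hρ hμ] at h2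
    filter_upwards [h1, h2, hf, hp] with x h3 h4 h5 h6
    obtain ⟨h7, h8⟩ := h4
    rw [h3, h5, h6]
    field_simp
  have hφp : MemLp (fun x => φ x * polyL2 hρ' p x) 2 (densMeasure ρ) := by
    refine (MemLp.mul_polynomial hρ' (hred.memLp_reducer hρ') p).ae_eq ?_
    filter_upwards [hp] with x hx
    rw [hx]
  have hTpρ : MemLp (opT ρ μ (polyL2 hρ' p)) 2 (densMeasure ρ) :=
    (hρ'.memLp_polynomial (secPoly hρ' p)).ae_eq (Filter.EventuallyEq.symm hTp)
  filter_upwards [hred.eq_reducer_mul_sub hρ hμ (U f).2 hk hφp hTpρ, hp, hTp] with x h1 h2 h3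
  rw [h1, h2, h3, secondary_polynomial hρ']

theorem existsUnique_extendsU (hρ : IsProbabilityDensity ρ) (hμ : IsSecondaryDensity ρ μ)
    (hred : IsReducible ρ μ φ) : ∃! U, ExtendsU ρ μ φ U := by
  obtain ⟨U, hU⟩ := exists_opTRestrict_comp hρ hμ hred
  have hext := extendsU_of_comp hρ hμ hred hU
  refine ⟨U, hext, fun V hV => ?_⟩
  have hq := hred.isDensity_quotDensity hμ.toIsDensity
  refine ContinuousLinearMap.coeFn_injective ((denseRange_polyL2 hq).equalizer V.continuous
    U.continuous (funext fun p => Subtype.ext (Lp.ext ?_)))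
  exact (hV p _ (coeFn_polyL2 hq p)).trans (hext p _ (coeFn_polyL2 hq p)).symm

theorem extendsU_opU (hρ : IsProbabilityDensity ρ) (hμ : IsSecondaryDensity ρ μ)
    (hred : IsReducible ρ μ φ) : ExtendsU ρ μ φ (opU ρ μ φ) := by
  have h := existsUnique_extendsU hρ hμ hred
  rw [opU, dif_pos h]
  exact h.exists.choose_spec

/-- By uniqueness of the extension, `opU` is the operator built from the inverse of T; the inverse
formulas follow from this factorization. -/
theorem opTRestrict_opU (hρ : IsProbabilityDensity ρ) (hμ : IsSecondaryDensity ρ μ)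
    (hred : IsReducible ρ μ φ) (h : L2 (quotDensity ρ μ)) :
    opTRestrict ρ μ (opU ρ μ φ h) = opFSymm hρ hμ hred h := by
  obtain ⟨U, hU⟩ := exists_opTRestrict_comp hρ hμ hred
  rw [(existsUnique_extendsU hρ hμ hred).unique (extendsU_opU hρ hμ hred)
    (extendsU_of_comp hρ hμ hred hU), hU]

theorem isometry_opU (hρ : IsProbabilityDensity ρ) (hμ : IsSecondaryDensity ρ μ)
    (hred : IsReducible ρ μ φ) : Isometry (opU ρ μ φ) := by
  refine Isometry.of_dist_eq fun f g => ?_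
  rw [← (isometry_opTRestrict hρ hμ).dist_eq, opTRestrict_opU hρ hμ hred,
    opTRestrict_opU hρ hμ hred, (opFSymm hρ hμ hred).isometry.dist_eq]

theorem opF_opTRestrict_opU (hρ : IsProbabilityDensity ρ) (hμ : IsSecondaryDensity ρ μ)
    (hred : IsReducible ρ μ φ) (h : L2 (quotDensity ρ μ)) :
    opF ρ μ (opTRestrict ρ μ (opU ρ μ φ h)) = h := by
  rw [opTRestrict_opU hρ hμ hred, opF_opFSymm hρ hμ hred]

theorem opTRestrict_opU_opF (hρ : IsProbabilityDensity ρ) (hμ : IsSecondaryDensity ρ μ)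
    (hred : IsReducible ρ μ φ) (g : L2 μ) :
    opTRestrict ρ μ (opU ρ μ φ (opF ρ μ g)) = g := by
  rw [opTRestrict_opU hρ hμ hred, opFSymm_opF hρ hμ hred]

theorem opU_opF_opTRestrict (hρ : IsProbabilityDensity ρ) (hμ : IsSecondaryDensity ρ μ)
    (hred : IsReducible ρ μ φ) (f : hyperplane ρ) :
    opU ρ μ φ (opF ρ μ (opTRestrict ρ μ f)) = f :=
  (isometry_opTRestrict hρ hμ).injective (opTRestrict_opU_opF hρ hμ hred _)

theorem solvesEquation_opU_opF (hρ : IsProbabilityDensity ρ) (hμ : IsSecondaryDensity ρ μ)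
    (hred : IsReducible ρ μ φ) (g : L2 μ) :
    SolvesEquation ρ μ g (opU ρ μ φ (opF ρ μ g) : L2 ρ) := by
  have hT : opT ρ μ (opU ρ μ φ (opF ρ μ g)) = g := opTRestrict_opU_opF hρ hμ hred g
  refine ⟨Subtype.prop _, by rw [hT], ?_⟩
  rw [← hred.ae_eq_ae_left hρ hμ, hμ.toIsDensity.ae_iff]
  filter_upwards [hred.isReducer.ae_opT_eq_secondary hρ hμ (opU ρ μ φ (opF ρ μ g))] with x hx h hint
  exact (hx h hint).symm.trans (by rw [hT])

/-- The singular integral of a Lipschitz function converges absolutely. -/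
theorem integrableOn_secondary_of_lipschitzOnWith {k : ℝ → ℝ} {C : NNReal}
    (hρ : IsDensity ρ) (hk : LipschitzOnWith C k (Icc 0 1)) {x : ℝ} (hx : x ∈ Icc (0 : ℝ) 1) :
    IntegrableOn (fun t => (k t - k x) / (t - x) * ρ t) (Icc 0 1) ∧
      ‖secondary ρ k x‖ ≤ C * ∫ t in Icc (0 : ℝ) 1, ‖ρ t‖ := by
  have hb : ∀ᵐ t ∂volume.restrict (Icc (0 : ℝ) 1), ‖(k t - k x) / (t - x)‖ ≤ C := by
    filter_upwards [ae_restrict_mem measurableSet_Icc] with t ht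
    have h1 := hk.dist_le_mul t ht x hx
    rw [dist_eq_norm, dist_eq_norm] at h1
    rw [norm_div]
    exact div_le_of_le_mul₀ (norm_nonneg _) C.2 h1
  refine ⟨hρ.integrable.bdd_mul ?_ hb, ?_⟩
  · have h1 := hk.continuousOn.aestronglyMeasurable (μ := volume) measurableSet_Icc
    exact ((h1.aemeasurable.sub_const _).div
      (measurable_id.sub_const x).aemeasurable).aestronglyMeasurable
  · rw [← integral_const_mul]
    refine norm_integral_le_of_norm_le (hρ.integrable.norm.const_mul _) ?_
    filter_upwards [hb] with t ht
    rw [norm_mul]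
    gcongr

theorem opT_eq_secondary_of_lipschitzOnWith (hρ : IsProbabilityDensity ρ)
    (hμ : IsSecondaryDensity ρ μ) (hred : IsReducible ρ μ φ) {K : ℝ → ℝ} {C : NNReal}
    (hK : LipschitzOnWith C K (Icc 0 1)) {k : L2 ρ} (hk : k =ᵐ[densMeasure ρ] K) :
    opT ρ μ k =ᵐ[densMeasure μ] secondary ρ K := by
  rw [Filter.EventuallyEq, hμ.toIsDensity.ae_iff]
  have hkρ := hρ.toIsDensity.mul_congr_ae hk
  have hkx := hk
  rw [Filter.EventuallyEq, ← hred.ae_eq_ae_left hρ hμ, hμ.toIsDensity.ae_iff] at hkx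
  filter_upwards [hred.isReducer.ae_opT_eq_secondary hρ hμ k, hkx,
    ae_restrict_mem measurableSet_Icc] with x h1 h2 hxI hx
  have h3 : (fun t => (k t - k x) / (t - x) * ρ t) =ᵐ[volume.restrict (Icc (0 : ℝ) 1)]
      fun t => (K t - K x) / (t - x) * ρ t := by
    filter_upwards [hkρ] with t ht
    rw [h2 hx]
    linear_combination (t - x)⁻¹ * ht
  have h4 := (integrableOn_secondary_of_lipschitzOnWith hρ.toIsDensity hK hxI).1
  rw [h1 hx (Integrable.congr h4 h3.symm)]
  exact integral_congr_ae h3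

/-- `K` is bounded, so it multiplies φ and ρ/μ within their L² spaces, and the difference quotients
of `K` bound T(k). -/
theorem isComposable_of_lipschitzOnWith (hρ : IsProbabilityDensity ρ)
    (hμ : IsSecondaryDensity ρ μ) (hred : IsReducible ρ μ φ) {K : ℝ → ℝ} {C : NNReal}
    (hK : LipschitzOnWith C K (Icc 0 1)) {k : L2 ρ} (hk : k =ᵐ[densMeasure ρ] K) :
    IsComposable ρ μ φ k := by
  have := hρ.toIsDensity.isFiniteMeasure
  have hTk := opT_eq_secondary_of_lipschitzOnWith hρ hμ hred hK hk
  have hkμ := hk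
  rw [Filter.EventuallyEq, ← hred.ae_eq_ae_left hρ hμ] at hkμ
  refine ⟨?_, ?_, ?_⟩
  · refine ((hρ.toIsDensity.memLp_of_continuousOn hK.continuousOn (p := ⊤)).mul'
      (hred.memLp_reducer hρ.toIsDensity)).ae_eq ?_
    filter_upwards [hk] with x hx
    rw [hx]
  · refine MemLp.of_bound ?_ (C * ∫ t in Icc (0 : ℝ) 1, ‖ρ t‖) ?_
    · exact (Lp.aestronglyMeasurable (opT ρ μ k)).mono_ac
        (Measure.ae_le_iff_absolutelyContinuous.1 (hred.ae_eq_ae_left hρ hμ).ge)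
    · rw [Filter.EventuallyEq, hred.ae_eq_ae_left hρ hμ] at hTk
      filter_upwards [hTk, ae_mem_Icc_densMeasure ρ] with x h1 h2
      rw [h1]
      exact (integrableOn_secondary_of_lipschitzOnWith hρ.toIsDensity hK h2).2
  · refine ((hμ.toIsDensity.memLp_of_continuousOn hK.continuousOn (p := ⊤)).mul'
      hred.memLp_quotient).ae_eq ?_
    filter_upwards [hkμ] with x hx
    rw [hx]

end OperatorU

theorem mainTheorem5 (ρ μ φ : ℝ → ℝ) (hρ : IsProbabilityDensity ρ)
    (hμ : IsSecondaryDensity ρ μ) (hred : IsReducible ρ μ φ) :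
    -- `T_ρ` and `U_ρ` are well defined, `T_ρ` is isometric on `H_ρ`, and `U_ρ` is isometric
    ((∃! T, ExtendsSecondary ρ μ T) ∧ ExtendsSecondary ρ μ (opT ρ μ) ∧
      Isometry (opTRestrict ρ μ)) ∧
    ((∃! U, ExtendsU ρ μ φ U) ∧ ExtendsU ρ μ φ (opU ρ μ φ) ∧ Isometry (opU ρ μ φ)) ∧
    -- multiplication by `μ / ρ` is well defined from `L²(μ)` to `L²(ρ² / μ)`
    (∀ g : L2 μ, opF ρ μ g =ᵐ[densMeasure (quotDensity ρ μ)] fun x => μ x / ρ x * g x) ∧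
    -- bijectivity and the inverses
    Function.Bijective (opU ρ μ φ) ∧
    Function.Bijective (opTRestrict ρ μ) ∧
    (Function.LeftInverse (opF ρ μ ∘ opTRestrict ρ μ) (opU ρ μ φ) ∧
      Function.RightInverse (opF ρ μ ∘ opTRestrict ρ μ) (opU ρ μ φ)) ∧
    (Function.LeftInverse (opU ρ μ φ ∘ opF ρ μ) (opTRestrict ρ μ) ∧
      Function.RightInverse (opU ρ μ φ ∘ opF ρ μ) (opTRestrict ρ μ)) ∧
    -- solution of the integral equation
    (∀ g : L2 μ, SolvesEquation ρ μ g (opU ρ μ φ (opF ρ μ g) : L2 ρ)) ∧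
    (∀ (g : L2 μ) (k : L2 ρ), k =ᵐ[densMeasure ρ] (fun x => μ x / ρ x * g x) →
      IsComposable ρ μ φ k →
      (opU ρ μ φ (opF ρ μ g) : L2 ρ) =ᵐ[densMeasure ρ] fun x => φ x * k x - opT ρ μ k x) ∧
    -- the case of a function of class `C¹`
    (∀ K : ℝ → ℝ, ContDiffOn ℝ 1 K (Icc 0 1) →
      ∃ k : L2 ρ, k =ᵐ[densMeasure ρ] K ∧ IsComposable ρ μ φ k ∧
        opT ρ μ k =ᵐ[densMeasure μ] secondary ρ K) := by
  refine ⟨⟨existsUnique_extendsSecondary hρ hμ, extendsSecondary_opT hρ hμ,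
      isometry_opTRestrict hρ hμ⟩,
    ⟨existsUnique_extendsU hρ hμ hred, extendsU_opU hρ hμ hred, isometry_opU hρ hμ hred⟩,
    hred.coeFn_opF hρ hμ,
    ⟨(isometry_opU hρ hμ hred).injective, fun f => ⟨_, opU_opF_opTRestrict hρ hμ hred f⟩⟩,
    bijective_opTRestrict hρ hμ,
    ⟨opF_opTRestrict_opU hρ hμ hred, opU_opF_opTRestrict hρ hμ hred⟩,
    ⟨opU_opF_opTRestrict hρ hμ hred, opTRestrict_opU_opF hρ hμ hred⟩,
    solvesEquation_opU_opF hρ hμ hred, fun g k hk hc => ?_, fun K hK => ?_⟩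
  · have hT : opT ρ μ (opU ρ μ φ (opF ρ μ g)) = g := opTRestrict_opU_opF hρ hμ hred g
    rw [← hT] at hk
    exact hred.eq_reducer_mul_sub hρ hμ (Subtype.prop _) hk hc.mul_memLp hc.opT_memLp
  -- A C¹ function on a compact convex set is Lipschitz, which is all that the preceding lemmas
  -- need.
  · obtain ⟨C, hC⟩ := hK.exists_lipschitzOnWith one_ne_zero (convex_Icc (0 : ℝ) 1) isCompact_Icc
    have hk := (hρ.toIsDensity.memLp_of_continuousOn hC.continuousOn (p := 2)).coeFn_toLp
    exact ⟨_, hk, isComposable_of_lipschitzOnWith hρ hμ hred hC hk,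
      opT_eq_secondary_of_lipschitzOnWith hρ hμ hred hC hk⟩
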